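/- Let $D,d\ge 1$ be integers and let $G=(V,E)$ be a finite, non-empty, simple $D$-regular graph with $n=|V|$ vertices. Place a $d$-dimensional particle (qudit) at each vertex, so that the total Hilbert space is $(\mathbb{C}^d)^{\otimes n}$. For every edge $\{i,j\}\in E$ let $H_{i,j}$ be a Hermitian operator on $(\mathbb{C}^d)^{\otimes n}$ that acts only on the qudits $i$ and $j$ (that is, it is the tensor product of an operator on these two qudits with the identity on the others) and has operator norm $\|H_{i,j}\|\le 1$. Let $$H=\mathop{\mathbb{E}}_{\{i,j\}\in E}H_{i,j}=\frac{2}{nD}\sum_{\{i,j\}\in E}H_{i,j},$$ the sum being over unordered edges, and let $e_0(H)=\min\{\langle\psi|H|\psi\rangle:\langle\psi|\psi\rangle=1\}$ be the ground-state energy of $H$. Then there are unit vectors $|\varphi_v\rangle\in\mathbb{C}^d$, $v\in V$, such that the product state $|\varphi\rangle=\bigotimes_{v\in V}|\varphi_v\rangle$, with density matrix $\varphi=|\varphi\rangle\langle\varphi|$, satisfies $$\operatorname{tr}(H\varphi)\le e_0(H)+12\left(\frac{d^2\ln d}{D}\right)^{1/3}.$$ -/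

import Mathlib

noncomputable section

/-- The Hilbert space of one `d`-dimensional particle at each site `v : V`, i.e. the tensor product
of copies of `ℂ^d` over `V`, in coordinates with respect to the product basis, which is indexed by
the configurations `x : V → Fin d`. -/
abbrev QuditSpace (V : Type*) [Fintype V] (d : ℕ) := EuclideanSpace ℂ (V → Fin d)

/-- Operators on `QuditSpace V d`, as matrices in the product basis. -/
abbrev QuditOp (V : Type*) (d : ℕ) := Matrix (V → Fin d) (V → Fin d) ℂ

/-- The operator norm (largest singular value) of a matrix, for the Euclidean norm on vectors. -/
def opNorm {V : Type*} [Fintype V] [DecidableEq V] {d : ℕ} (A : QuditOp V d) : ℝ :=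
  ‖Matrix.toEuclideanCLM (𝕜 := ℂ) A‖

open Classical in
/-- `A` acts only on the qudits in `S`: it is `K ⊗ I` for some operator `K` on the qudits in `S`,
where `I` is the identity on the other qudits. -/
def ActsOnlyOn {V : Type*} {d : ℕ} (S : Set V) (A : QuditOp V d) : Prop :=
  ∃ K : Matrix (S → Fin d) (S → Fin d) ℂ, ∀ x y : V → Fin d,
    A x y = if ∀ v, v ∉ S → x v = y v then K (fun s => x s) (fun s => y s) else 0

/-- The Hamiltonian `𝔼_{e ∈ E} h e`: the average of the terms `h e` over the (unordered) edges `e`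
of `G`. -/
def edgeAverage {V : Type*} [Fintype V] [DecidableEq V] (G : SimpleGraph V) [DecidableRel G.Adj]
    {d : ℕ} (h : Sym2 V → QuditOp V d) : QuditOp V d :=
  (1 / (G.edgeFinset.card : ℂ)) • ∑ e ∈ G.edgeFinset, h e

/-- On a `D`-regular graph with `n` vertices the average over the edges is `2 / (n D)` times
the sum over the edges. -/
theorem edgeAverage_eq {V : Type*} [Fintype V] [DecidableEq V] (G : SimpleGraph V)
    [DecidableRel G.Adj] {d D : ℕ} (hG : G.IsRegularOfDegree D) (h : Sym2 V → QuditOp V d) :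
    edgeAverage G h
      = (2 / ((Fintype.card V : ℂ) * (D : ℂ))) • ∑ e ∈ G.edgeFinset, h e := by
  have h1 : Fintype.card V * D = 2 * G.edgeFinset.card := by
    rw [← G.sum_degrees_eq_twice_card_edges]
    simp [hG.degree_eq]
  have h2 : (Fintype.card V : ℂ) * (D : ℂ) = 2 * (G.edgeFinset.card : ℂ) := by
    exact_mod_cast h1
  rw [edgeAverage, h2, ← div_div, div_self two_ne_zero]

/-- The expectation `⟨ψ|H|ψ⟩` (its real part; it is real when `H` is Hermitian). -/
def expectation {V : Type*} [Fintype V] [DecidableEq V] {d : ℕ}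
    (H : QuditOp V d) (ψ : QuditSpace V d) : ℝ :=
  (inner ℂ ψ (Matrix.toEuclideanCLM (𝕜 := ℂ) H ψ)).re

/-- The ground-state energy `e₀(H) = min {⟨ψ|H|ψ⟩ : ⟨ψ|ψ⟩ = 1}`. -/
def groundEnergy {V : Type*} [Fintype V] [DecidableEq V] {d : ℕ} (H : QuditOp V d) : ℝ :=
  sInf (expectation H '' {ψ : QuditSpace V d | ‖ψ‖ = 1})

/-- The infimum that defines the ground-state energy is a minimum. -/
theorem isLeast_groundEnergy {V : Type*} [Fintype V] [DecidableEq V] {d : ℕ} (hd : 0 < d)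
    (H : QuditOp V d) :
    IsLeast (expectation H '' {ψ : QuditSpace V d | ‖ψ‖ = 1}) (groundEnergy H) := by
  have hs : {ψ : QuditSpace V d | ‖ψ‖ = 1} = Metric.sphere 0 1 := by
    ext ψ; simp
  have hc : Continuous (expectation H) := by
    unfold expectation
    fun_prop
  refine IsCompact.isLeast_sInf ?_ ?_
  · rw [hs]
    exact (isCompact_sphere _ _).image hc
  · exact ⟨_, EuclideanSpace.single (fun _ => ⟨0, hd⟩) 1, by simp, rfl⟩

/-- The product vector `⊗_v φ_v`. -/
def productVector {V : Type*} [Fintype V] {d : ℕ} (φ : V → EuclideanSpace ℂ (Fin d)) :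
    QuditSpace V d :=
  WithLp.toLp 2 (fun x => ∏ v, φ v (x v))

/-- The density matrix `|ψ⟩⟨ψ|` of a vector `ψ`. -/
def pureDensity {V : Type*} [Fintype V] {d : ℕ} (ψ : QuditSpace V d) : QuditOp V d :=
  Matrix.of fun x y => ψ x * star (ψ y)

end

/-!
Fix a rank-one measurement of one particle from whose outcome statistics, at two sites, every
two-site observable of norm at most one can be recovered as a function of the two outcomes with
second moment at most `24 d²` in every state. Measure every site of a ground state `ψ`. Given the
outcomes on a small set `C` of sites, let the other sites be independent, each in its conditional
post-measurement state: to obtain a product of pure states, every site draws its own outcomes for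
the rest of the system. At an edge `{i, j}` that misses `C`, averaging this product state over the
outcomes only replaces the joint law of the two outcomes by the product of its marginals given
`C`, so a form of Pinsker's inequality bounds the change of the energy by `√(96 d² I(i : j | C))`.

Adding a random site `v` to `C` raises the mutual information between the site `i` and `C` by
`I(i : v | C)` on average, while this mutual information never exceeds `log d`. Hence, along a
greedy chain of sets `C` of size `k = 0, …, n - 1`, the mean of `I(i : j | C)` over edges and steps
is at most `|V| log d / (n D)`. The edges meeting `C` add at most `4 |C| / |V|` to the average
energy, and `n ≈ 2 (d² log d / D)^(1/3) |V|` balances the two errors.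
-/

section Frames

open Matrix ComplexConjugate Kronecker

variable {ι κ X Y : Type*} [Fintype X] [Fintype Y]

/-- A Parseval frame of `ℂ^ι`: the vectors `f x` resolve the identity, `∑ x, |f x⟩⟨f x| = 1`.
Equivalently, they are the (unnormalised) outcomes of a rank-one measurement. -/
def IsParsevalFrame [DecidableEq ι] (f : X → ι → ℂ) : Prop :=
  ∑ x, vecMulVec (f x) (star (f x)) = 1

theorem isParsevalFrame_iff [DecidableEq ι] {f : X → ι → ℂ} :
    IsParsevalFrame f ↔ ∀ a b, ∑ x, f x a * conj (f x b) = (1 : Matrix ι ι ℂ) a b := by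
  simp only [IsParsevalFrame, ← Matrix.ext_iff, Matrix.sum_apply, vecMulVec_apply, Pi.star_apply,
    RCLike.star_def]

protected theorem IsParsevalFrame.star [DecidableEq ι] {f : X → ι → ℂ} (hf : IsParsevalFrame f) :
    IsParsevalFrame fun x => star (f x) := by
  rw [isParsevalFrame_iff] at hf ⊢
  intro a b
  rw [← transpose_apply 1 b a, transpose_one, ← hf b a]
  simp [mul_comm]

/-- The product vector `u ⊗ v` in `ℂ^ι ⊗ ℂ^κ = ℂ^(ι × κ)`. -/
def tensorVec (u : ι → ℂ) (v : κ → ℂ) : ι × κ → ℂ := fun p => u p.1 * v p.2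

theorem tensorVec_smul_smul (a b : ℂ) (u : ι → ℂ) (v : κ → ℂ) :
    tensorVec (a • u) (b • v) = (a * b) • tensorVec u v := by
  ext p
  simp [tensorVec, mul_mul_mul_comm]

theorem vecMulVec_tensorVec (u u' : ι → ℂ) (v v' : κ → ℂ) :
    vecMulVec (tensorVec u v) (star (tensorVec u' v'))
      = vecMulVec u (star u') ⊗ₖ vecMulVec v (star v') := by
  ext p q
  simp [tensorVec, vecMulVec_apply, kroneckerMap_apply, mul_mul_mul_comm]

theorem IsParsevalFrame.tensor [DecidableEq ι] [DecidableEq κ] {f : X → ι → ℂ} {g : Y → κ → ℂ}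
    (hf : IsParsevalFrame f) (hg : IsParsevalFrame g) :
    IsParsevalFrame fun p : X × Y => tensorVec (f p.1) (g p.2) := by
  simp only [IsParsevalFrame, vecMulVec_tensorVec, Fintype.sum_prod_type]
  rw [← one_kronecker_one, ← hf, ← hg]
  ext p q
  simp [Matrix.sum_apply, kroneckerMap_apply, Finset.sum_mul_sum]

/-- The product vector `⊗_v φ_v` in `⊗_v ℂ^ι = ℂ^(V → ι)`. -/
def piTensorVec {V : Type*} [Fintype V] (φ : V → ι → ℂ) : (V → ι) → ℂ := fun y => ∏ v, φ v (y v)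

theorem IsParsevalFrame.pi {V : Type*} [Fintype V] [DecidableEq V] [DecidableEq ι]
    {f : V → X → ι → ℂ} (hf : ∀ v, IsParsevalFrame (f v)) :
    IsParsevalFrame fun o : V → X => piTensorVec fun v => f v (o v) := by
  simp only [isParsevalFrame_iff] at hf ⊢
  intro x y
  calc ∑ o : V → X, (∏ v, f v (o v) (x v)) * conj (∏ v, f v (o v) (y v))
      = ∏ v, ∑ k, f v k (x v) * conj (f v k (y v)) := by
        simp only [map_prod, ← Finset.prod_mul_distrib]
        exact (Fintype.prod_sum fun v k => f v k (x v) * conj (f v k (y v))).symm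
    _ = (1 : Matrix (V → ι) (V → ι) ℂ) x y := by
        simp only [hf, one_apply, Finset.prod_ite_zero, Finset.prod_const_one, funext_iff,
          Finset.mem_univ, true_imp_iff]

variable [Fintype ι] [Fintype κ]

theorem ofReal_sum_norm_sq (φ : ι → ℂ) : ((∑ a, ‖φ a‖ ^ 2 : ℝ) : ℂ) = star φ ⬝ᵥ φ := by
  simp only [Complex.ofReal_sum, Complex.ofReal_pow, ← Complex.conj_mul', dotProduct,
    Pi.star_apply, RCLike.star_def]

theorem norm_sq_star_dotProduct_le (u v : ι → ℂ) :
    ‖star u ⬝ᵥ v‖ ^ 2 ≤ (∑ a, ‖u a‖ ^ 2) * ∑ a, ‖v a‖ ^ 2 := by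
  have triangle : ‖star u ⬝ᵥ v‖ ≤ ∑ a, ‖u a‖ * ‖v a‖ :=
    (norm_sum_le _ _).trans_eq (by simp)
  exact (pow_le_pow_left₀ (norm_nonneg _) triangle 2).trans (Finset.sum_mul_sq_le_sq_mul_sq _ _ _)

theorem star_dotProduct_vecMulVec_mulVec (u v φ : ι → ℂ) :
    star φ ⬝ᵥ vecMulVec u (star v) *ᵥ φ = star φ ⬝ᵥ u * (star v ⬝ᵥ φ) := by
  simp [vecMulVec_mulVec, mul_comm]

theorem star_dotProduct_vecMulVec_self_mulVec (u φ : ι → ℂ) :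
    star φ ⬝ᵥ vecMulVec u (star u) *ᵥ φ = (‖star u ⬝ᵥ φ‖ ^ 2 : ℝ) := by
  rw [star_dotProduct_vecMulVec_mulVec, star_dotProduct, Complex.ofReal_pow, ← Complex.conj_mul']
  rfl

theorem star_tensorVec_dotProduct (u : ι → ℂ) (v : κ → ℂ) (χ : ι × κ → ℂ) :
    star (tensorVec u v) ⬝ᵥ χ = star u ⬝ᵥ fun a => star v ⬝ᵥ fun b => χ (a, b) := by
  simp [tensorVec, dotProduct, Fintype.sum_prod_type, Finset.mul_sum, mul_assoc]

theorem star_tensorVec_dotProduct' (u : ι → ℂ) (v : κ → ℂ) (χ : ι × κ → ℂ) :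
    star (tensorVec u v) ⬝ᵥ χ = star v ⬝ᵥ fun b => star u ⬝ᵥ fun a => χ (a, b) := by
  simp only [tensorVec, dotProduct, Fintype.sum_prod_type_right, Finset.mul_sum, Pi.star_apply,
    star_mul', mul_assoc, mul_left_comm]

theorem star_tensorVec_dotProduct_tensorVec (u u' : ι → ℂ) (v v' : κ → ℂ) :
    star (tensorVec u v) ⬝ᵥ tensorVec u' v' = (star u ⬝ᵥ u') * (star v ⬝ᵥ v') := by
  simp only [tensorVec, dotProduct, Fintype.sum_prod_type, Pi.star_apply, star_mul',
    Finset.sum_mul_sum, mul_mul_mul_comm]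

theorem sum_norm_sq_tensorVec (u : ι → ℂ) (v : κ → ℂ) :
    ∑ p, ‖tensorVec u v p‖ ^ 2 = (∑ a, ‖u a‖ ^ 2) * ∑ b, ‖v b‖ ^ 2 := by
  simp only [tensorVec, Fintype.sum_prod_type, norm_mul, mul_pow, Finset.sum_mul_sum]

namespace IsParsevalFrame

variable [DecidableEq ι] {f : X → ι → ℂ}

theorem sum_norm_sq_dotProduct (hf : IsParsevalFrame f) (φ : ι → ℂ) :
    ∑ x, ‖star (f x) ⬝ᵥ φ‖ ^ 2 = ∑ a, ‖φ a‖ ^ 2 := by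
  apply Complex.ofReal_injective
  rw [ofReal_sum_norm_sq φ, Complex.ofReal_sum]
  simp only [← star_dotProduct_vecMulVec_self_mulVec]
  rw [← dotProduct_sum, ← sum_mulVec, hf, one_mulVec]

theorem sum_sum_norm_sq (hf : IsParsevalFrame f) :
    ∑ x, ∑ a, ‖f x a‖ ^ 2 = Fintype.card ι := by
  have column (a : ι) : ∑ x, ‖f x a‖ ^ 2 = 1 := by
    simpa [Pi.single_apply, apply_ite norm, ite_pow] using
      hf.sum_norm_sq_dotProduct (Pi.single a 1)
  rw [Finset.sum_comm]
  simp [column]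

theorem sum_smul_vecMulVec (hf : IsParsevalFrame f) (K : Matrix ι ι ℂ) :
    ∑ x, ∑ y, (star (f x) ⬝ᵥ K *ᵥ f y) • vecMulVec (f x) (star (f y)) = K := by
  calc ∑ x, ∑ y, (star (f x) ⬝ᵥ K *ᵥ f y) • vecMulVec (f x) (star (f y))
      = ∑ x, ∑ y, vecMulVec (f x) (star (f x)) * (K * vecMulVec (f y) (star (f y))) := by
        simp only [mul_vecMulVec K, vecMulVec_mul_vecMulVec, vecMulVec_smul]
    _ = (∑ x, vecMulVec (f x) (star (f x))) * (K * ∑ y, vecMulVec (f y) (star (f y))) := by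
        simp only [Finset.mul_sum, Finset.sum_mul]
        exact Finset.sum_comm
    _ = K := by rw [hf, one_mul, mul_one]

end IsParsevalFrame

end Frames

section SecondMoment

open Matrix

variable {ι X : Type*} [Fintype ι]

/-- The operator `A` does not increase the Euclidean norm. -/
def IsContraction (A : Matrix ι ι ℂ) : Prop :=
  ∀ φ : ι → ℂ, ∑ a, ‖(A *ᵥ φ) a‖ ^ 2 ≤ ∑ a, ‖φ a‖ ^ 2

theorem star_dotProduct_mulVec_of_isHermitian {K : Matrix ι ι ℂ} (hK : K.IsHermitian)
    (u v : ι → ℂ) : star (star u ⬝ᵥ K *ᵥ v) = star v ⬝ᵥ K *ᵥ u := by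
  rw [← star_dotProduct_star, star_star, star_mulVec, hK.eq, ← dotProduct_mulVec]

/-- The matrix element `⟨f x ⊗ f x'|K|f y ⊗ f y'⟩`, where `p = (x, x')` and `q = (y, y')`. -/
def frameElement (f : X → ι → ℂ) (K : Matrix (ι × ι) (ι × ι) ℂ) (p q : X × X) : ℂ :=
  star (tensorVec (f p.1) (f p.2)) ⬝ᵥ K *ᵥ tensorVec (f q.1) (f q.2)

variable {f : X → ι → ℂ} {K : Matrix (ι × ι) (ι × ι) ℂ}

theorem norm_frameElement_comm (hK : K.IsHermitian) (p q : X × X) :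
    ‖frameElement f K p q‖ = ‖frameElement f K q p‖ := by
  rw [frameElement, ← norm_star, star_dotProduct_mulVec_of_isHermitian hK, frameElement]

/-- For fixed `x` and `y'` the matrix elements `⟨f x ⊗ f x'|K|f y ⊗ f y'⟩` are the coefficients
of one vector of `ℂ^ι ⊗ ℂ^ι` along the product vectors `f x' ⊗ conj (f y)`. -/
theorem frameElement_eq_dotProduct [DecidableEq ι] (x x' y y' : X) :
    frameElement f K (x, x') (y, y') = star (tensorVec (f x') (star (f y))) ⬝ᵥ fun p =>
      star (f x) ⬝ᵥ fun a => (K *ᵥ tensorVec (Pi.single p.2 1) (f y')) (a, p.1) := by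
  have h : tensorVec (f y) (f y') = ∑ c, f y c • tensorVec (Pi.single c 1) (f y') := by
    ext p
    simp [tensorVec, Finset.sum_apply, Pi.single_apply]
  rw [frameElement, star_tensorVec_dotProduct', star_tensorVec_dotProduct, h]
  congr 1
  ext b
  simp only [mulVec_sum, mulVec_smul, Finset.sum_apply, Pi.smul_apply, star_star, dotProduct,
    Finset.mul_sum, smul_eq_mul]
  rw [Finset.sum_comm]
  simp only [mul_left_comm]

variable [Fintype X]

theorem sum_norm_sq_dotProduct_mul_le {τ : ℝ} (hτ₀ : 0 ≤ τ)
    (hτ : ∀ c : ι → ℂ, ∑ x, ‖star (f x) ⬝ᵥ c‖ ^ 4 ≤ τ * (∑ a, ‖c a‖ ^ 2) ^ 2) (c e : ι → ℂ) :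
    ∑ x, ‖star (f x) ⬝ᵥ c‖ ^ 2 * ‖star (f x) ⬝ᵥ e‖ ^ 2
      ≤ τ * (∑ a, ‖c a‖ ^ 2) * ∑ a, ‖e a‖ ^ 2 := by
  refine le_of_sq_le_sq ?_ (by positivity)
  calc (∑ x, ‖star (f x) ⬝ᵥ c‖ ^ 2 * ‖star (f x) ⬝ᵥ e‖ ^ 2) ^ 2
      ≤ (∑ x, (‖star (f x) ⬝ᵥ c‖ ^ 2) ^ 2) * ∑ x, (‖star (f x) ⬝ᵥ e‖ ^ 2) ^ 2 :=
        Finset.sum_mul_sq_le_sq_mul_sq _ _ _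
    _ ≤ (τ * (∑ a, ‖c a‖ ^ 2) ^ 2) * (τ * (∑ a, ‖e a‖ ^ 2) ^ 2) := by
        simp only [← pow_mul]
        gcongr <;> apply hτ
    _ = (τ * (∑ a, ‖c a‖ ^ 2) * ∑ a, ‖e a‖ ^ 2) ^ 2 := by ring

variable [DecidableEq ι] (hf : IsParsevalFrame f) (hK : IsContraction K)

include hf hK

theorem sum_norm_sq_frameElement_le {ρ : ℝ} (hρ : ∀ x, ∑ a, ‖f x a‖ ^ 2 ≤ ρ) (q : X × X) :
    ∑ p, ‖frameElement f K p q‖ ^ 2 ≤ ρ ^ 2 := by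
  calc ∑ p, ‖frameElement f K p q‖ ^ 2
      = ∑ a, ‖(K *ᵥ tensorVec (f q.1) (f q.2)) a‖ ^ 2 := (hf.tensor hf).sum_norm_sq_dotProduct _
    _ ≤ (∑ a, ‖f q.1 a‖ ^ 2) * ∑ a, ‖f q.2 a‖ ^ 2 := (hK _).trans (sum_norm_sq_tensorVec _ _).le
    _ ≤ ρ ^ 2 := by
      rw [sq]
      gcongr
      · exact (Finset.sum_nonneg fun _ _ => by positivity).trans (hρ q.1)
      · exact hρ _
      · exact hρ _

theorem sum_norm_sq_frameElement_mul_le {ρ : ℝ} (hρ : ∀ x, ∑ a, ‖f x a‖ ^ 2 ≤ ρ)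
    (χ : ι × ι → ℂ) :
    ∑ p, ∑ q, ‖frameElement f K p q‖ ^ 2 * ‖star (tensorVec (f q.1) (f q.2)) ⬝ᵥ χ‖ ^ 2
      ≤ ρ ^ 2 * ∑ a, ‖χ a‖ ^ 2 := by
  rw [Finset.sum_comm, ← (hf.tensor hf).sum_norm_sq_dotProduct, Finset.mul_sum]
  simp only [← Finset.sum_mul]
  gcongr with q
  exact sum_norm_sq_frameElement_le hf hK hρ q

variable {τ : ℝ} (hτ₀ : 0 ≤ τ)
  (hτ : ∀ c : ι → ℂ, ∑ x, ‖star (f x) ⬝ᵥ c‖ ^ 4 ≤ τ * (∑ a, ‖c a‖ ^ 2) ^ 2)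

include hτ₀ hτ

theorem sum_norm_sq_frameElement_mul_norm_sq_dotProduct_le (y' : X) (c : ι → ℂ) :
    ∑ x, ∑ q : X × X, ‖frameElement f K (x, q.1) (q.2, y')‖ ^ 2 * ‖star (f x) ⬝ᵥ c‖ ^ 2
      ≤ τ * Fintype.card ι * (∑ b, ‖f y' b‖ ^ 2) * ∑ a, ‖c a‖ ^ 2 := by
  set v : ι × ι → ι → ℂ := fun p a => (K *ᵥ tensorVec (Pi.single p.2 1) (f y')) (a, p.1) with hv
  have hsum (x : X) : ∑ q : X × X, ‖frameElement f K (x, q.1) (q.2, y')‖ ^ 2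
      = ∑ p, ‖star (f x) ⬝ᵥ v p‖ ^ 2 := by
    simp only [frameElement_eq_dotProduct]
    exact (hf.tensor hf.star).sum_norm_sq_dotProduct _
  have hnorm : ∑ p, ∑ a, ‖v p a‖ ^ 2 ≤ Fintype.card ι * ∑ b, ‖f y' b‖ ^ 2 := by
    calc ∑ p, ∑ a, ‖v p a‖ ^ 2
        = ∑ s, ∑ p, ‖(K *ᵥ tensorVec (Pi.single s 1) (f y')) p‖ ^ 2 := by
          simp only [hv, Fintype.sum_prod_type_right]
      _ ≤ ∑ _s : ι, ∑ b, ‖f y' b‖ ^ 2 := by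
          gcongr with s
          refine (hK _).trans (le_of_eq ?_)
          rw [sum_norm_sq_tensorVec]
          simp [Pi.single_apply, apply_ite norm, ite_pow]
      _ = Fintype.card ι * ∑ b, ‖f y' b‖ ^ 2 := by simp
  calc ∑ x, ∑ q : X × X, ‖frameElement f K (x, q.1) (q.2, y')‖ ^ 2 * ‖star (f x) ⬝ᵥ c‖ ^ 2
      = ∑ p, ∑ x, ‖star (f x) ⬝ᵥ v p‖ ^ 2 * ‖star (f x) ⬝ᵥ c‖ ^ 2 := by
        simp only [← Finset.sum_mul, hsum]
        simp only [Finset.sum_mul]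
        exact Finset.sum_comm
    _ ≤ ∑ p, τ * (∑ a, ‖v p a‖ ^ 2) * ∑ a, ‖c a‖ ^ 2 := by
        gcongr with p
        exact sum_norm_sq_dotProduct_mul_le hτ₀ hτ _ _
    _ = τ * (∑ p, ∑ a, ‖v p a‖ ^ 2) * ∑ a, ‖c a‖ ^ 2 := by rw [← Finset.sum_mul, ← Finset.mul_sum]
    _ ≤ τ * (Fintype.card ι * ∑ b, ‖f y' b‖ ^ 2) * ∑ a, ‖c a‖ ^ 2 := by gcongr
    _ = τ * Fintype.card ι * (∑ b, ‖f y' b‖ ^ 2) * ∑ a, ‖c a‖ ^ 2 := by ring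

theorem sum_norm_sq_frameElement_mul_mixed_le {ρ : ℝ} (hρ : ∀ x, ∑ a, ‖f x a‖ ^ 2 ≤ ρ)
    (χ : ι × ι → ℂ) :
    ∑ p, ∑ q, ‖frameElement f K p q‖ ^ 2 * ‖star (tensorVec (f p.1) (f q.2)) ⬝ᵥ χ‖ ^ 2
      ≤ τ * Fintype.card ι * ρ * ∑ a, ‖χ a‖ ^ 2 := by
  let c (y' : X) (a : ι) : ℂ := star (f y') ⬝ᵥ fun b => χ (a, b)
  calc ∑ p, ∑ q, ‖frameElement f K p q‖ ^ 2 * ‖star (tensorVec (f p.1) (f q.2)) ⬝ᵥ χ‖ ^ 2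
      = ∑ y', ∑ x, ∑ q : X × X,
          ‖frameElement f K (x, q.1) (q.2, y')‖ ^ 2 * ‖star (f x) ⬝ᵥ c y'‖ ^ 2 := by
        simp only [star_tensorVec_dotProduct, Fintype.sum_prod_type, c]
        symm
        rw [Finset.sum_comm]
        refine Finset.sum_congr rfl fun x _ => ?_
        rw [Finset.sum_comm]
        exact Finset.sum_congr rfl fun x' _ => Finset.sum_comm
    _ ≤ ∑ y', τ * Fintype.card ι * ρ * ∑ a, ‖c y' a‖ ^ 2 := by
        gcongr with y'
        refine (sum_norm_sq_frameElement_mul_norm_sq_dotProduct_le hf hK hτ₀ hτ y' _).trans ?_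
        gcongr
        exact hρ y'
    _ = τ * Fintype.card ι * ρ * ∑ a, ‖χ a‖ ^ 2 := by
        rw [← Finset.mul_sum, Finset.sum_comm]
        simp only [c, hf.sum_norm_sq_dotProduct, Fintype.sum_prod_type]

end SecondMoment

section Polarization

open Matrix ComplexConjugate Kronecker

/-- The fourth root of unity `i ^ k`. -/
def phase (k : Fin 4) : ℂ := Complex.I ^ (k : ℕ)

theorem norm_phase (k : Fin 4) : ‖phase k‖ = 1 := by simp [phase]

theorem conj_phase_mul_phase (k : Fin 4) : conj (phase k) * phase k = 1 := by
  simp [Complex.conj_mul', norm_phase]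

theorem sum_norm_sq_add_conj_phase_mul (s a : ℂ) :
    ∑ k, ‖s + conj (phase k) * a‖ ^ 2 = 4 * (‖s‖ ^ 2 + ‖a‖ ^ 2) := by
  simp only [← Complex.normSq_eq_norm_sq, phase, Fin.sum_univ_four, Complex.normSq_apply]
  simp [pow_succ]
  ring

theorem sum_norm_pow_four_add_conj_phase_mul (s a : ℂ) :
    ∑ k, ‖s + conj (phase k) * a‖ ^ 4 = 4 * (‖s‖ ^ 4 + 4 * ‖s‖ ^ 2 * ‖a‖ ^ 2 + ‖a‖ ^ 4) := by
  have pow_four (z : ℂ) : ‖z‖ ^ 4 = (z.re * z.re + z.im * z.im) ^ 2 := by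
    rw [← Complex.normSq_apply, Complex.normSq_eq_norm_sq, ← pow_mul]
  simp only [pow_four, ← Complex.normSq_eq_norm_sq, phase, Fin.sum_univ_four, Complex.normSq_apply]
  simp [pow_succ]
  ring

variable {ι : Type*}

theorem sum_vecMulVec_add_phase_smul (u v : ι → ℂ) :
    ∑ w, vecMulVec (u + phase w • v) (star (u + phase w • v))
      = (4 : ℂ) • (vecMulVec u (star u) + vecMulVec v (star v)) := by
  ext a b
  simp only [phase, Fin.sum_univ_four, Matrix.add_apply, Matrix.smul_apply, vecMulVec_apply]
  simp [pow_succ]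
  ring_nf
  simp
  ring

/-- Since `∑ w = ∑ w² = 0` over the fourth roots of unity `w`, only the term `w̄ |u⟩⟨v|` of
`|u + w v⟩⟨u + w v|` survives the average against `w`. -/
theorem sum_phase_smul_vecMulVec_add_phase_smul (u v : ι → ℂ) :
    ∑ w, phase w • vecMulVec (u + phase w • v) (star (u + phase w • v))
      = (4 : ℂ) • vecMulVec u (star v) := by
  ext a b
  simp only [phase, Fin.sum_univ_four, Matrix.add_apply, Matrix.smul_apply, vecMulVec_apply]
  simp [pow_succ]
  ring_nf
  simp
  ring

theorem sum_norm_sq_star_tensorVec_add_phase_smul_dotProduct [Fintype ι] (u v u' v' : ι → ℂ)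
    (χ : ι × ι → ℂ) :
    ∑ w, ∑ w', ‖star (tensorVec (u + phase w • v) (u' + phase w' • v')) ⬝ᵥ χ‖ ^ 2
      = 16 * (‖star (tensorVec u u') ⬝ᵥ χ‖ ^ 2 + ‖star (tensorVec v u') ⬝ᵥ χ‖ ^ 2
        + ‖star (tensorVec u v') ⬝ᵥ χ‖ ^ 2 + ‖star (tensorVec v v') ⬝ᵥ χ‖ ^ 2) := by
  have left (w : Fin 4) (t : ι → ℂ) : star (tensorVec (u + phase w • v) t) ⬝ᵥ χ
      = star (tensorVec u t) ⬝ᵥ χ + conj (phase w) * (star (tensorVec v t) ⬝ᵥ χ) := by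
    simp [star_tensorVec_dotProduct, add_dotProduct]
  have right (w : Fin 4) (t : ι → ℂ) : star (tensorVec t (u' + phase w • v')) ⬝ᵥ χ
      = star (tensorVec t u') ⬝ᵥ χ + conj (phase w) * (star (tensorVec t v') ⬝ᵥ χ) := by
    simp [star_tensorVec_dotProduct', add_dotProduct]
  rw [Finset.sum_comm]
  simp only [left, sum_norm_sq_add_conj_phase_mul]
  simp only [right, ← Finset.mul_sum, Finset.sum_add_distrib, sum_norm_sq_add_conj_phase_mul]
  ring

variable {X : Type*} [Fintype X]

/-- The measurement with outcomes `(x, y, w)`, where `w` is a fourth root of unity, given by the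
superpositions `f x + w • f y`, normalised to be a Parseval frame if `f` is one. -/
noncomputable def polarizedFrame (f : X → ι → ℂ) (o : X × X × Fin 4) : ι → ℂ :=
  (√(8 * Fintype.card X) : ℂ)⁻¹ • (f o.1 + phase o.2.2 • f o.2.1)

theorem vecMulVec_polarizedFrame (f : X → ι → ℂ) (o : X × X × Fin 4) :
    vecMulVec (polarizedFrame f o) (star (polarizedFrame f o))
      = (8 * Fintype.card X : ℂ)⁻¹ • vecMulVec (f o.1 + phase o.2.2 • f o.2.1)
          (star (f o.1 + phase o.2.2 • f o.2.1)) := by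
  have h : (√(8 * Fintype.card X) : ℂ) * √(8 * Fintype.card X) = 8 * Fintype.card X := by
    rw [← Complex.ofReal_mul, Real.mul_self_sqrt (by positivity)]
    push_cast
    rfl
  simp only [polarizedFrame, smul_vecMulVec, star_smul, vecMulVec_smul, smul_smul, star_inv₀,
    RCLike.star_def, Complex.conj_ofReal, ← mul_inv, h]

theorem IsParsevalFrame.isParsevalFrame_polarizedFrame [Nonempty X] [DecidableEq ι] {f : X → ι → ℂ}
    (hf : IsParsevalFrame f) : IsParsevalFrame (polarizedFrame f) := by
  have hN : (Fintype.card X : ℂ) ≠ 0 := Nat.cast_ne_zero.mpr Fintype.card_ne_zero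
  simp only [IsParsevalFrame, vecMulVec_polarizedFrame, Fintype.sum_prod_type, ← Finset.smul_sum,
    sum_vecMulVec_add_phase_smul, Finset.sum_add_distrib, Finset.sum_const, Finset.card_univ]
  rw [hf, ← two_smul ℂ, ← Nat.cast_smul_eq_nsmul ℂ]
  simp only [smul_smul]
  convert one_smul ℂ _
  field_simp
  norm_num

/-- The coefficients of `K` in terms of the outcomes of two measurements `polarizedFrame f`. -/
def polarizedCoeff [Fintype ι] (f : X → ι → ℂ) (K : Matrix (ι × ι) (ι × ι) ℂ)
    (o : (X × X × Fin 4) × (X × X × Fin 4)) : ℂ :=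
  4 * Fintype.card X ^ 2 * (phase o.1.2.2 * phase o.2.2.2)
    * frameElement f K (o.1.1, o.2.1) (o.1.2.1, o.2.2.1)

theorem norm_polarizedCoeff_sq [Fintype ι] (f : X → ι → ℂ) (K : Matrix (ι × ι) (ι × ι) ℂ)
    (o : (X × X × Fin 4) × (X × X × Fin 4)) :
    ‖polarizedCoeff f K o‖ ^ 2 = 16 * Fintype.card X ^ 4
      * ‖frameElement f K (o.1.1, o.2.1) (o.1.2.1, o.2.2.1)‖ ^ 2 := by
  simp [polarizedCoeff, norm_phase]
  ring

theorem sum_phase_smul_vecMulVec_polarizedFrame (f : X → ι → ℂ) (x y : X) :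
    ∑ w, phase w • vecMulVec (polarizedFrame f (x, y, w)) (star (polarizedFrame f (x, y, w)))
      = (2 * Fintype.card X : ℂ)⁻¹ • vecMulVec (f x) (star (f y)) := by
  simp only [vecMulVec_polarizedFrame, smul_comm (phase _)]
  rw [← Finset.smul_sum, sum_phase_smul_vecMulVec_add_phase_smul, smul_smul]
  congr 1
  ring

theorem sum_prod_prod_comm {W M : Type*} [Fintype W] [AddCommMonoid M]
    (F : (X × X × W) × (X × X × W) → M) :
    ∑ o, F o = ∑ p : X × X, ∑ q : X × X, ∑ w, ∑ w', F ((p.1, q.1, w), (p.2, q.2, w')) := by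
  let e : (X × X × W) × (X × X × W) ≃ (X × X) × (X × X) × W × W :=
    { toFun o := ((o.1.1, o.2.1), (o.1.2.1, o.2.2.1), o.1.2.2, o.2.2.2)
      invFun p := ((p.1.1, p.2.1.1, p.2.2.1), (p.1.2, p.2.1.2, p.2.2.2)) }
  rw [← e.symm.sum_comp]
  simp only [Fintype.sum_prod_type (α₁ := X × X), Fintype.sum_prod_type (α₁ := W)]
  rfl

variable [Fintype ι]

theorem IsParsevalFrame.sum_polarizedCoeff_smul [Nonempty X] [DecidableEq ι] {f : X → ι → ℂ}
    (hf : IsParsevalFrame f) (K : Matrix (ι × ι) (ι × ι) ℂ) :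
    ∑ o, polarizedCoeff f K o • vecMulVec (tensorVec (polarizedFrame f o.1) (polarizedFrame f o.2))
      (star (tensorVec (polarizedFrame f o.1) (polarizedFrame f o.2))) = K := by
  have hN : (Fintype.card X : ℂ) ≠ 0 := Nat.cast_ne_zero.mpr Fintype.card_ne_zero
  let P (x y : X) (w : Fin 4) : Matrix ι ι ℂ :=
    vecMulVec (polarizedFrame f (x, y, w)) (star (polarizedFrame f (x, y, w)))
  have sum_phases (p q : X × X) :
      ∑ w, ∑ w', polarizedCoeff f K ((p.1, q.1, w), (p.2, q.2, w')) •
        (P p.1 q.1 w ⊗ₖ P p.2 q.2 w')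
      = (4 * Fintype.card X ^ 2 * frameElement f K p q) •
        ((∑ w, phase w • P p.1 q.1 w) ⊗ₖ ∑ w', phase w' • P p.2 q.2 w') := by
    ext a b
    simp only [polarizedCoeff, Prod.mk.eta, Matrix.sum_apply, Matrix.smul_apply, kroneckerMap_apply,
      smul_eq_mul]
    rw [Finset.sum_mul_sum]
    simp only [Finset.mul_sum]
    exact Finset.sum_congr rfl fun _ _ => Finset.sum_congr rfl fun _ _ => by ring
  rw [sum_prod_prod_comm]
  refine Eq.trans ?_ ((hf.tensor hf).sum_smul_vecMulVec K)
  refine Finset.sum_congr rfl fun p _ => Finset.sum_congr rfl fun q _ => ?_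
  simp only [vecMulVec_tensorVec]
  rw [sum_phases, sum_phase_smul_vecMulVec_polarizedFrame, sum_phase_smul_vecMulVec_polarizedFrame,
    smul_kronecker, kronecker_smul, smul_smul, smul_smul]
  congr 1
  field_simp
  norm_num [frameElement]

theorem norm_sq_star_tensorVec_polarizedFrame_dotProduct (f : X → ι → ℂ) (o o' : X × X × Fin 4)
    (χ : ι × ι → ℂ) :
    ‖star (tensorVec (polarizedFrame f o) (polarizedFrame f o')) ⬝ᵥ χ‖ ^ 2
      = (64 * Fintype.card X ^ 2 : ℝ)⁻¹ * ‖star (tensorVec (f o.1 + phase o.2.2 • f o.2.1)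
          (f o'.1 + phase o'.2.2 • f o'.2.1)) ⬝ᵥ χ‖ ^ 2 := by
  simp only [polarizedFrame, tensorVec_smul_smul, star_smul, smul_dotProduct, norm_smul, mul_pow,
    norm_star, norm_mul, norm_inv, Complex.norm_real, inv_pow, Real.norm_eq_abs, sq_abs]
  rw [Real.sq_sqrt (by positivity)]
  ring

theorem sum_norm_polarizedCoeff_sq_mul [Nonempty X] (f : X → ι → ℂ)
    (K : Matrix (ι × ι) (ι × ι) ℂ) (χ : ι × ι → ℂ) :
    ∑ o, ‖polarizedCoeff f K o‖ ^ 2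
        * ‖star (tensorVec (polarizedFrame f o.1) (polarizedFrame f o.2)) ⬝ᵥ χ‖ ^ 2
      = 4 * Fintype.card X ^ 2 * ∑ p, ∑ q, ‖frameElement f K p q‖ ^ 2
        * (‖star (tensorVec (f p.1) (f p.2)) ⬝ᵥ χ‖ ^ 2
          + ‖star (tensorVec (f q.1) (f p.2)) ⬝ᵥ χ‖ ^ 2
          + ‖star (tensorVec (f p.1) (f q.2)) ⬝ᵥ χ‖ ^ 2
          + ‖star (tensorVec (f q.1) (f q.2)) ⬝ᵥ χ‖ ^ 2) := by
  have hN : (Fintype.card X : ℝ) ≠ 0 := Nat.cast_ne_zero.mpr Fintype.card_ne_zero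
  simp only [sum_prod_prod_comm, Finset.mul_sum]
  refine Finset.sum_congr rfl fun p _ => Finset.sum_congr rfl fun q _ => ?_
  simp only [norm_polarizedCoeff_sq, norm_sq_star_tensorVec_polarizedFrame_dotProduct,
    ← Finset.mul_sum, sum_norm_sq_star_tensorVec_add_phase_smul_dotProduct]
  field_simp
  ring

end Polarization

section Distortion

open Matrix ComplexConjugate

variable {ι X Ω : Type*} [Fintype ι] [Fintype X] [Fintype Ω]

/-- The second-moment form of informational completeness: every two-particle observable `K` of norm
at most one is a function `h` of the outcomes of measuring both particles with `m`, and the mean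
square of `h` in every state is at most `S`. -/
def HasDistortion (m : Ω → ι → ℂ) (S : ℝ) : Prop :=
  ∀ K : Matrix (ι × ι) (ι × ι) ℂ, K.IsHermitian → IsContraction K → ∃ h : Ω × Ω → ℝ,
    K = ∑ o, (h o : ℂ) •
      vecMulVec (tensorVec (m o.1) (m o.2)) (star (tensorVec (m o.1) (m o.2))) ∧
    ∀ χ : ι × ι → ℂ, ∑ o, h o ^ 2 * ‖star (tensorVec (m o.1) (m o.2)) ⬝ᵥ χ‖ ^ 2
      ≤ S * ∑ a, ‖χ a‖ ^ 2

theorem eq_sum_re_smul_vecMulVec {κ : Type*} {K : Matrix κ κ ℂ} (hK : K.IsHermitian)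
    {c : Ω → ℂ} {u : Ω → κ → ℂ} (h : ∑ o, c o • vecMulVec (u o) (star (u o)) = K) :
    K = ∑ o, ((c o).re : ℂ) • vecMulVec (u o) (star (u o)) := by
  have h' : ∑ o, conj (c o) • vecMulVec (u o) (star (u o)) = K := by
    rw [← hK.eq, ← h, conjTranspose_sum]
    simp only [conjTranspose_smul, conjTranspose_vecMulVec, star_star, RCLike.star_def]
  calc K = (2 : ℂ)⁻¹ • (K + K) := by rw [← two_smul ℂ K, smul_smul]; simp
    _ = (2 : ℂ)⁻¹ • (∑ o, c o • vecMulVec (u o) (star (u o))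
          + ∑ o, conj (c o) • vecMulVec (u o) (star (u o))) := by rw [h, h']
    _ = ∑ o, ((c o).re : ℂ) • vecMulVec (u o) (star (u o)) := by
      rw [← Finset.sum_add_distrib, Finset.smul_sum]
      refine Finset.sum_congr rfl fun o _ => ?_
      rw [← add_smul, smul_smul, Complex.add_conj]
      congr 1
      push_cast
      ring

theorem IsParsevalFrame.hasDistortion_polarizedFrame [Nonempty X] [DecidableEq ι] {f : X → ι → ℂ}
    (hf : IsParsevalFrame f) {ρ τ : ℝ} (hρ : ∀ x, ∑ a, ‖f x a‖ ^ 2 ≤ ρ) (hτ₀ : 0 ≤ τ)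
    (hτ : ∀ c : ι → ℂ, ∑ x, ‖star (f x) ⬝ᵥ c‖ ^ 4 ≤ τ * (∑ a, ‖c a‖ ^ 2) ^ 2) :
    HasDistortion (polarizedFrame f)
      (8 * Fintype.card X ^ 2 * (ρ ^ 2 + τ * Fintype.card ι * ρ)) := by
  intro K hK hK₁
  refine ⟨fun o => (polarizedCoeff f K o).re,
    eq_sum_re_smul_vecMulVec hK (hf.sum_polarizedCoeff_smul K), fun χ => ?_⟩
  let F (p q : X × X) : ℝ := ‖frameElement f K p q‖ ^ 2
  let T (x x' : X) : ℝ := ‖star (tensorVec (f x) (f x')) ⬝ᵥ χ‖ ^ 2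
  have F_comm (p q : X × X) : F p q = F q p := by simp only [F, norm_frameElement_comm hK p q]
  have direct : ∑ p, ∑ q, F p q * T q.1 q.2 ≤ ρ ^ 2 * ∑ a, ‖χ a‖ ^ 2 :=
    sum_norm_sq_frameElement_mul_le hf hK₁ hρ χ
  have mixed : ∑ p, ∑ q, F p q * T p.1 q.2 ≤ τ * Fintype.card ι * ρ * ∑ a, ‖χ a‖ ^ 2 :=
    sum_norm_sq_frameElement_mul_mixed_le hf hK₁ hτ₀ hτ hρ χ
  have direct' : ∑ p, ∑ q, F p q * T p.1 p.2 ≤ ρ ^ 2 * ∑ a, ‖χ a‖ ^ 2 := by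
    rw [Finset.sum_comm]
    simpa only [F_comm] using direct
  have mixed' : ∑ p, ∑ q, F p q * T q.1 p.2 ≤ τ * Fintype.card ι * ρ * ∑ a, ‖χ a‖ ^ 2 := by
    rw [Finset.sum_comm]
    simpa only [F_comm] using mixed
  calc ∑ o, (polarizedCoeff f K o).re ^ 2
        * ‖star (tensorVec (polarizedFrame f o.1) (polarizedFrame f o.2)) ⬝ᵥ χ‖ ^ 2
      ≤ ∑ o, ‖polarizedCoeff f K o‖ ^ 2
        * ‖star (tensorVec (polarizedFrame f o.1) (polarizedFrame f o.2)) ⬝ᵥ χ‖ ^ 2 := by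
        refine Finset.sum_le_sum fun o _ => mul_le_mul_of_nonneg_right
          (sq_le_sq.mpr ((Complex.abs_re_le_norm _).trans (le_abs_self _))) (by positivity)
    _ = 4 * Fintype.card X ^ 2 * (∑ p, ∑ q, F p q * T p.1 p.2 + ∑ p, ∑ q, F p q * T q.1 p.2
          + ∑ p, ∑ q, F p q * T p.1 q.2 + ∑ p, ∑ q, F p q * T q.1 q.2) := by
        simp only [sum_norm_polarizedCoeff_sq_mul, mul_add, Finset.sum_add_distrib, F, T]
    _ ≤ 4 * Fintype.card X ^ 2 * (ρ ^ 2 * ∑ a, ‖χ a‖ ^ 2 + τ * Fintype.card ι * ρ * ∑ a, ‖χ a‖ ^ 2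
          + τ * Fintype.card ι * ρ * ∑ a, ‖χ a‖ ^ 2 + ρ ^ 2 * ∑ a, ‖χ a‖ ^ 2) := by gcongr
    _ = 8 * Fintype.card X ^ 2 * (ρ ^ 2 + τ * Fintype.card ι * ρ) * ∑ a, ‖χ a‖ ^ 2 := by ring

end Distortion

section PhaseFrame

open Matrix ComplexConjugate

variable {d : ℕ}

/-- The `4 ^ d` vectors in `ℂ^d` whose entries are fourth roots of unity, normalised to be a
Parseval frame. -/
noncomputable def phaseVec (x : Fin d → Fin 4) (a : Fin d) : ℂ := phase (x a) / 2 ^ d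

theorem sum_norm_sq_phaseVec (x : Fin d → Fin 4) : ∑ a, ‖phaseVec x a‖ ^ 2 = d / 4 ^ d := by
  have h : ((2 : ℝ) ^ d) ^ 2 = 4 ^ d := by rw [← pow_mul, mul_comm, pow_mul]; norm_num
  simp [phaseVec, norm_phase, div_eq_mul_inv, h]

theorem phase_add_one (k : Fin 4) : phase (k + 1) = Complex.I * phase k := by
  fin_cases k <;> simp [phase, Fin.add_def, pow_succ]

theorem sum_phase_mul_conj_phase_of_ne {a b : Fin d} (hab : a ≠ b) :
    ∑ x : Fin d → Fin 4, phase (x a) * conj (phase (x b)) = 0 := by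
  have rotate : ∑ x : Fin d → Fin 4, phase (x a) * conj (phase (x b))
      = Complex.I * ∑ x : Fin d → Fin 4, phase (x a) * conj (phase (x b)) := by
    conv_lhs => rw [← Equiv.sum_comp (Equiv.addRight (Pi.single a (1 : Fin 4)))]
    simp [phase_add_one, hab.symm, Finset.mul_sum, mul_assoc]
  have hI : (1 - Complex.I) ≠ 0 := fun h => by simpa using congrArg Complex.re h
  exact (mul_eq_zero.mp (by linear_combination rotate : (1 - Complex.I) * _ = 0)).resolve_left hI

theorem isParsevalFrame_phaseVec : IsParsevalFrame (phaseVec (d := d)) := by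
  refine isParsevalFrame_iff.mpr fun a b => ?_
  have h : (2 ^ d * 2 ^ d : ℂ) = 4 ^ d := by rw [← mul_pow]; norm_num
  simp only [phaseVec, map_div₀, map_pow, Complex.conj_ofNat, div_mul_div_comm, h,
    ← Finset.sum_div, one_apply]
  split_ifs with hab
  · subst hab
    simp [mul_comm (phase _), conj_phase_mul_phase]
  · simp [sum_phase_mul_conj_phase_of_ne hab]

theorem star_phaseVec_dotProduct (x : Fin d → Fin 4) (c : Fin d → ℂ) :
    star (phaseVec x) ⬝ᵥ c = (∑ a, conj (phase (x a)) * c a) / 2 ^ d := by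
  simp only [dotProduct, phaseVec, Pi.star_apply, RCLike.star_def, map_div₀, map_pow,
    Complex.conj_ofNat, Finset.sum_div, div_mul_eq_mul_div]

theorem sum_norm_sq_sum_conj_phase_mul (c : Fin d → ℂ) :
    ∑ x : Fin d → Fin 4, ‖∑ a, conj (phase (x a)) * c a‖ ^ 2 = 4 ^ d * ∑ a, ‖c a‖ ^ 2 := by
  have h : ((2 : ℝ) ^ d) ^ 2 = 4 ^ d := by rw [← pow_mul, mul_comm, pow_mul]; norm_num
  rw [← isParsevalFrame_phaseVec.sum_norm_sq_dotProduct c]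
  simp only [star_phaseVec_dotProduct, norm_div, norm_pow, Complex.norm_ofNat, div_pow, h,
    ← Finset.sum_div]
  field_simp

theorem sum_norm_pow_four_sum_conj_phase_mul_le : ∀ {d : ℕ} (c : Fin d → ℂ),
    ∑ x : Fin d → Fin 4, ‖∑ a, conj (phase (x a)) * c a‖ ^ 4
      ≤ 2 * 4 ^ d * (∑ a, ‖c a‖ ^ 2) ^ 2
  | 0, c => by simp
  | d + 1, c => by
    let s (x : Fin d → Fin 4) : ℂ := ∑ a, conj (phase (x a)) * c a.succ
    let C : ℝ := ∑ a : Fin d, ‖c a.succ‖ ^ 2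
    calc ∑ x : Fin (d + 1) → Fin 4, ‖∑ a, conj (phase (x a)) * c a‖ ^ 4
        = ∑ x, ∑ k, ‖s x + conj (phase k) * c 0‖ ^ 4 := by
          rw [← (Fin.consEquiv fun _ => Fin 4).sum_comp, Fintype.sum_prod_type_right]
          simp [Fin.sum_univ_succ, Fin.consEquiv, s, add_comm (_ * c 0)]
      _ = 4 * (∑ x, ‖s x‖ ^ 4 + 4 * (4 ^ d * C) * ‖c 0‖ ^ 2 + 4 ^ d * ‖c 0‖ ^ 4) := by
          simp only [sum_norm_pow_four_add_conj_phase_mul, ← Finset.mul_sum,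
            Finset.sum_add_distrib, ← Finset.sum_mul,
            show ∑ x, ‖s x‖ ^ 2 = 4 ^ d * C from sum_norm_sq_sum_conj_phase_mul _]
          simp
      _ ≤ 4 * (2 * 4 ^ d * C ^ 2 + 4 * (4 ^ d * C) * ‖c 0‖ ^ 2 + 4 ^ d * ‖c 0‖ ^ 4) := by
          gcongr
          exact sum_norm_pow_four_sum_conj_phase_mul_le _
      _ ≤ 2 * 4 ^ (d + 1) * (‖c 0‖ ^ 2 + C) ^ 2 := by
          have : (0 : ℝ) ≤ 4 ^ d * ‖c 0‖ ^ 4 := by positivity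
          rw [pow_succ (4 : ℝ) d]
          linear_combination 4 * this
      _ = _ := by rw [Fin.sum_univ_succ]

theorem sum_norm_pow_four_star_phaseVec_dotProduct_le (c : Fin d → ℂ) :
    ∑ x, ‖star (phaseVec x) ⬝ᵥ c‖ ^ 4 ≤ 2 / 4 ^ d * (∑ a, ‖c a‖ ^ 2) ^ 2 := by
  have h : ((2 : ℝ) ^ d) ^ 4 = 4 ^ d * 4 ^ d := by
    rw [← mul_pow, ← pow_mul, mul_comm, pow_mul]; norm_num
  calc ∑ x, ‖star (phaseVec x) ⬝ᵥ c‖ ^ 4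
      = (∑ x : Fin d → Fin 4, ‖∑ a, conj (phase (x a)) * c a‖ ^ 4) / (4 ^ d * 4 ^ d) := by
        simp only [star_phaseVec_dotProduct, norm_div, norm_pow, Complex.norm_ofNat, div_pow, h,
          ← Finset.sum_div]
    _ ≤ 2 * 4 ^ d * (∑ a, ‖c a‖ ^ 2) ^ 2 / (4 ^ d * 4 ^ d) := by
        gcongr
        exact sum_norm_pow_four_sum_conj_phase_mul_le c
    _ = 2 / 4 ^ d * (∑ a, ‖c a‖ ^ 2) ^ 2 := by field_simp

theorem hasDistortion_polarizedFrame_phaseVec :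
    HasDistortion (polarizedFrame (phaseVec (d := d))) (24 * d ^ 2) := by
  convert isParsevalFrame_phaseVec.hasDistortion_polarizedFrame
    (fun x => (sum_norm_sq_phaseVec x).le) (by positivity)
    sum_norm_pow_four_star_phaseVec_dotProduct_le using 1
  simp only [Fintype.card_fun, Fintype.card_fin, Nat.cast_pow, Nat.cast_ofNat]
  field_simp
  ring

end PhaseFrame

section RelativeEntropy

variable {T : Type*} [Fintype T]

/-- The relative entropy `∑ t, p t log (p t / q t)` of two weight functions. -/
noncomputable def relEntropy (p q : T → ℝ) : ℝ := ∑ t, p t * Real.log (p t / q t)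

theorem sub_add_sq_sqrt_sub_sqrt_le {x y : ℝ} (hx : 0 ≤ x) (hy : 0 ≤ y) (hxy : 0 < x → 0 < y) :
    x - y + (√x - √y) ^ 2 ≤ x * Real.log (x / y) := by
  rcases hx.eq_or_lt with rfl | hx'
  · simp [hy]
  have hy' := hxy hx'
  have log_bound := Real.one_sub_inv_le_log_of_pos (x := √x / √y) (by positivity)
  calc x - y + (√x - √y) ^ 2 = x * (2 * (1 - (√x / √y)⁻¹)) := by
        have := Real.sqrt_ne_zero'.mpr hx'
        field_simp
        linear_combination (√x - 2 * √y) * Real.sq_sqrt hx + √x * Real.sq_sqrt hy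
    _ ≤ x * (2 * Real.log (√x / √y)) := by gcongr
    _ = x * Real.log (x / y) := by
        rw [← Real.sqrt_div hx, Real.log_sqrt (by positivity), mul_div_cancel₀ _ two_ne_zero]

variable {p q : T → ℝ} (hp : ∀ t, 0 ≤ p t) (hq : ∀ t, 0 ≤ q t) (hpq : ∀ t, 0 < p t → 0 < q t)
  (hsum : ∑ t, p t = ∑ t, q t)

include hp hq hpq hsum

theorem sum_sq_sqrt_sub_sqrt_le_relEntropy :
    ∑ t, (√(p t) - √(q t)) ^ 2 ≤ relEntropy p q := by
  calc ∑ t, (√(p t) - √(q t)) ^ 2 = ∑ t, (p t - q t + (√(p t) - √(q t)) ^ 2) := by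
        rw [Finset.sum_add_distrib, Finset.sum_sub_distrib, hsum, sub_self, zero_add]
    _ ≤ relEntropy p q :=
        Finset.sum_le_sum fun t _ => sub_add_sq_sqrt_sub_sqrt_le (hp t) (hq t) (hpq t)

theorem relEntropy_nonneg : 0 ≤ relEntropy p q :=
  (Finset.sum_nonneg fun _ _ => sq_nonneg _).trans
    (sum_sq_sqrt_sub_sqrt_le_relEntropy hp hq hpq hsum)

/-- A form of Pinsker's inequality in which the test function need only have bounded second
moments. -/
theorem sum_mul_sub_sum_mul_le_sqrt_relEntropy (h : T → ℝ) {S : ℝ}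
    (hpS : ∑ t, p t * h t ^ 2 ≤ S) (hqS : ∑ t, q t * h t ^ 2 ≤ S) :
    ∑ t, q t * h t - ∑ t, p t * h t ≤ √(4 * S * relEntropy p q) := by
  have second_moment : ∑ t, ((√(q t) + √(p t)) * h t) ^ 2 ≤ 4 * S := by
    calc ∑ t, ((√(q t) + √(p t)) * h t) ^ 2
        ≤ ∑ t, (2 * (p t * h t ^ 2) + 2 * (q t * h t ^ 2)) := by
          refine Finset.sum_le_sum fun t _ => ?_
          linear_combination mul_nonneg (sq_nonneg (√(q t) - √(p t))) (sq_nonneg (h t))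
            + 2 * h t ^ 2 * Real.sq_sqrt (hp t) + 2 * h t ^ 2 * Real.sq_sqrt (hq t)
      _ = 2 * ∑ t, p t * h t ^ 2 + 2 * ∑ t, q t * h t ^ 2 := by
          rw [Finset.sum_add_distrib, Finset.mul_sum, Finset.mul_sum]
      _ ≤ 4 * S := by linarith
  refine Real.le_sqrt_of_sq_le ?_
  calc (∑ t, q t * h t - ∑ t, p t * h t) ^ 2
      = (∑ t, (√(p t) - √(q t)) * ((√(q t) + √(p t)) * h t)) ^ 2 := by
        rw [← neg_sq, neg_sub, ← Finset.sum_sub_distrib]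
        congr 1
        refine Finset.sum_congr rfl fun t _ => ?_
        linear_combination h t * (Real.sq_sqrt (hq t) - Real.sq_sqrt (hp t))
    _ ≤ (∑ t, (√(p t) - √(q t)) ^ 2) * ∑ t, ((√(q t) + √(p t)) * h t) ^ 2 :=
        Finset.sum_mul_sq_le_sq_mul_sq _ _ _
    _ ≤ relEntropy p q * (4 * S) := by
        gcongr
        · exact relEntropy_nonneg hp hq hpq hsum
        · exact sum_sq_sqrt_sub_sqrt_le_relEntropy hp hq hpq hsum
    _ = 4 * S * relEntropy p q := mul_comm _ _

end RelativeEntropy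

section Information

variable {X A B Z : Type*} [Fintype X]

open Classical in
/-- The probability that `f = y` under the weights `P`. -/
noncomputable def prob (P : X → ℝ) (f : X → A) (y : A) : ℝ := ∑ x, if f x = y then P x else 0

open Classical in
/-- The weights `P` conditioned on `f = z`; they vanish if that event has probability zero. -/
noncomputable def condWeight (P : X → ℝ) (f : X → Z) (z : Z) (x : X) : ℝ :=
  (if f x = z then P x else 0) / prob P f z

/-- The Shannon entropy of `f` under the weights `P`. -/
noncomputable def entropy (P : X → ℝ) (f : X → A) : ℝ := -∑ x, P x * Real.log (prob P f (f x))

/-- The conditional mutual information `I(a : b | c)` under the weights `P`. -/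
noncomputable def condMutualInfo (P : X → ℝ) (a : X → A) (b : X → B) (c : X → Z) : ℝ :=
  entropy P (fun x => (a x, c x)) + entropy P (fun x => (b x, c x)) - entropy P c
    - entropy P (fun x => (a x, b x, c x))

/-- The joint distribution that `a`, `b` and `c` would have if `a` and `b` were independent
given `c`, with the same marginals. -/
noncomputable def condProd (P : X → ℝ) (a : X → A) (b : X → B) (c : X → Z) (t : A × B × Z) : ℝ :=
  prob P (fun x => (a x, c x)) (t.1, t.2.2) * prob P (fun x => (b x, c x)) (t.2.1, t.2.2)
    / prob P c t.2.2

variable {P : X → ℝ}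

theorem sum_prob_mul [Fintype A] (f : X → A) (G : A → ℝ) :
    ∑ y, prob P f y * G y = ∑ x, P x * G (f x) := by
  classical
  simp only [prob, Finset.sum_mul]
  rw [Finset.sum_comm]
  simp

theorem sum_prob [Fintype A] (f : X → A) : ∑ y, prob P f y = ∑ x, P x := by
  simpa using sum_prob_mul f fun _ => 1

theorem sum_prob_fst [Fintype A] (a : X → A) (c : X → Z) (z : Z) :
    ∑ y, prob P (fun x => (a x, c x)) (y, z) = prob P c z := by
  classical
  simp only [prob, Prod.mk.injEq, ite_and]
  rw [Finset.sum_comm]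
  simp

theorem sum_condWeight {f : X → Z} {z : Z} (hz : prob P f z ≠ 0) : ∑ x, condWeight P f z x = 1 := by
  simp only [condWeight, ← Finset.sum_div]
  exact div_self hz

theorem sum_condWeight_mul (P : X → ℝ) (f : X → Z) (z : Z) (G : X → ℝ) :
    ∑ x, condWeight P f z x * G x = prob (fun x => P x * G x) f z / prob P f z := by
  classical
  simp only [condWeight, div_mul_eq_mul_div, ← Finset.sum_div, ite_mul, zero_mul]
  rfl

theorem sum_condProd [Fintype A] [Fintype B] [Fintype Z] (a : X → A) (b : X → B) (c : X → Z) :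
    ∑ t, condProd P a b c t = ∑ x, P x := by
  rw [← sum_prob c]
  simp only [condProd, Fintype.sum_prod_type]
  rw [Finset.sum_congr rfl fun _ _ => Finset.sum_comm, Finset.sum_comm]
  simp only [← Finset.sum_div, ← Finset.mul_sum, sum_prob_fst, ← Finset.sum_mul,
    mul_self_div_self]

theorem prob_congr {f : X → A} {g : X → B} {y : A} {z : B} (h : ∀ x, f x = y ↔ g x = z) :
    prob P f y = prob P g z := by
  classical
  simp only [prob]
  exact Finset.sum_congr rfl fun x _ => if_congr (h x) rfl rfl

theorem exists_pos_of_prob_pos {f : X → A} {y : A} (h : 0 < prob P f y) :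
    ∃ x, f x = y ∧ 0 < P x := by
  classical
  obtain ⟨x, -, hx⟩ := Finset.exists_lt_of_sum_lt (s := Finset.univ) (f := fun _ => (0 : ℝ))
    (g := fun x => if f x = y then P x else 0) (by simpa [prob] using h)
  split_ifs at hx with hxy
  · exact ⟨x, hxy, hx⟩
  · exact absurd hx (lt_irrefl 0)

theorem entropy_congr {f : X → A} {g : X → B} (h : ∀ x y, f x = f y ↔ g x = g y) :
    entropy P f = entropy P g := by
  rw [entropy, entropy]
  congr 1
  refine Finset.sum_congr rfl fun x _ => ?_
  rw [prob_congr fun y => h y x]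

theorem condMutualInfo_comm (a : X → A) (b : X → B) (c : X → Z) :
    condMutualInfo P a b c = condMutualInfo P b a c := by
  have joint : entropy P (fun x => (a x, b x, c x)) = entropy P fun x => (b x, a x, c x) :=
    entropy_congr fun x y => by simp only [Prod.mk.injEq, and_left_comm]
  rw [condMutualInfo, condMutualInfo, joint, add_comm (entropy P fun x => (a x, c x))]

variable (hP : ∀ x, 0 ≤ P x)

include hP

theorem prob_nonneg (f : X → A) (y : A) : 0 ≤ prob P f y :=
  Finset.sum_nonneg fun x _ => by split_ifs <;> simp [hP]

theorem prob_le_prob {f : X → A} {g : X → B} {y : A} {z : B} (h : ∀ x, f x = y → g x = z) :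
    prob P f y ≤ prob P g z := by
  refine Finset.sum_le_sum fun x _ => ?_
  by_cases hx : f x = y
  · simp [hx, h x hx]
  · rw [if_neg hx]
    split_ifs <;> simp [hP]

theorem le_prob (f : X → A) (x : X) : P x ≤ prob P f (f x) := by
  classical
  calc P x = prob P id x := by simp [prob]
    _ ≤ prob P f (f x) := prob_le_prob hP fun y hy => congrArg f hy

theorem condWeight_nonneg (f : X → Z) (z : Z) (x : X) : 0 ≤ condWeight P f z x := by
  refine div_nonneg ?_ (prob_nonneg hP f z)
  split_ifs <;> simp [hP]

theorem condProd_nonneg (a : X → A) (b : X → B) (c : X → Z) (t : A × B × Z) :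
    0 ≤ condProd P a b c t :=
  div_nonneg (mul_nonneg (prob_nonneg hP _ _) (prob_nonneg hP _ _)) (prob_nonneg hP _ _)

theorem condProd_pos (a : X → A) (b : X → B) (c : X → Z) (t : A × B × Z)
    (h : 0 < prob P (fun x => (a x, b x, c x)) t) : 0 < condProd P a b c t := by
  refine div_pos (mul_pos ?_ ?_) ?_ <;>
  · refine h.trans_le (prob_le_prob hP fun x hx => ?_)
    simp [← hx]

theorem condMutualInfo_eq_relEntropy [Fintype A] [Fintype B] [Fintype Z] (a : X → A) (b : X → B)
    (c : X → Z) : condMutualInfo P a b c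
      = relEntropy (prob P fun x => (a x, b x, c x)) (condProd P a b c) := by
  have log_ratio (x : X) : P x * Real.log (prob P (fun x => (a x, b x, c x)) (a x, b x, c x)
        / condProd P a b c (a x, b x, c x))
      = P x * Real.log (prob P (fun x => (a x, b x, c x)) (a x, b x, c x))
        + P x * Real.log (prob P c (c x)) - P x * Real.log (prob P (fun x => (a x, c x)) (a x, c x))
        - P x * Real.log (prob P (fun x => (b x, c x)) (b x, c x)) := by
    rcases (hP x).eq_or_lt with h0 | h0
    · simp [← h0]
    have abc_pos := h0.trans_le (le_prob hP (fun x => (a x, b x, c x)) x)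
    have ac_pos := h0.trans_le (le_prob hP (fun x => (a x, c x)) x)
    have bc_pos := h0.trans_le (le_prob hP (fun x => (b x, c x)) x)
    have c_pos := h0.trans_le (le_prob hP c x)
    simp only [condProd]
    rw [div_div_eq_mul_div, Real.log_div (by positivity) (by positivity),
      Real.log_mul (by positivity) (by positivity), Real.log_mul (by positivity) (by positivity)]
    ring
  rw [relEntropy, sum_prob_mul (P := P) (fun x => (a x, b x, c x)) fun t =>
    Real.log (prob P (fun x => (a x, b x, c x)) t / condProd P a b c t)]
  simp only [log_ratio, Finset.sum_sub_distrib, Finset.sum_add_distrib, condMutualInfo, entropy]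
  ring

theorem condMutualInfo_nonneg [Finite A] [Finite B] [Finite Z] (a : X → A) (b : X → B)
    (c : X → Z) : 0 ≤ condMutualInfo P a b c := by
  have := Fintype.ofFinite A
  have := Fintype.ofFinite B
  have := Fintype.ofFinite Z
  rw [condMutualInfo_eq_relEntropy hP]
  exact relEntropy_nonneg (prob_nonneg hP _) (condProd_nonneg hP a b c) (condProd_pos hP a b c)
    (by rw [sum_condProd, sum_prob])

theorem sum_condProd_sub_le_sqrt_condMutualInfo [Fintype A] [Fintype B] [Fintype Z] (a : X → A)
    (b : X → B) (c : X → Z) (h : A × B × Z → ℝ) {S : ℝ} (hpS : ∑ x, P x * h (a x, b x, c x) ^ 2 ≤ S)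
    (hqS : ∑ t, condProd P a b c t * h t ^ 2 ≤ S) :
    ∑ t, condProd P a b c t * h t - ∑ x, P x * h (a x, b x, c x)
      ≤ √(4 * S * condMutualInfo P a b c) := by
  rw [condMutualInfo_eq_relEntropy hP, ← sum_prob_mul (fun x => (a x, b x, c x)) h]
  rw [← sum_prob_mul (fun x => (a x, b x, c x)) fun t => h t ^ 2] at hpS
  exact sum_mul_sub_sum_mul_le_sqrt_relEntropy (prob_nonneg hP _) (condProd_nonneg hP a b c)
    (condProd_pos hP a b c) (by rw [sum_condProd, sum_prob]) h hpS hqS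

theorem entropy_add_sum_mul_log_le_log [Fintype A] (hP₁ : ∑ x, P x = 1) (a : X → A) {μ : A → ℝ}
    {M : ℝ} (hM : 0 < M) (hμ₀ : ∀ y, 0 ≤ μ y) (hμ : ∑ y, μ y = M)
    (hμ_pos : ∀ x, 0 < P x → 0 < μ (a x)) :
    entropy P a + ∑ x, P x * Real.log (μ (a x)) ≤ Real.log M := by
  have gibbs : 0 ≤ relEntropy (prob P a) fun y => μ y / M :=
    relEntropy_nonneg (prob_nonneg hP a) (fun y => div_nonneg (hμ₀ y) hM.le)
      (fun y hy => by
        obtain ⟨x, rfl, hx⟩ := exists_pos_of_prob_pos hy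
        exact div_pos (hμ_pos x hx) hM)
      (by rw [sum_prob, hP₁, ← Finset.sum_div, hμ, div_self hM.ne'])
  have log_ratio (x : X) : P x * Real.log (prob P a (a x) / (μ (a x) / M))
      = P x * Real.log (prob P a (a x)) + P x * Real.log M - P x * Real.log (μ (a x)) := by
    rcases (hP x).eq_or_lt with h0 | h0
    · simp [← h0]
    have a_pos := h0.trans_le (le_prob hP a x)
    have μ_pos := hμ_pos x h0
    rw [div_div_eq_mul_div, Real.log_div (by positivity) (by positivity),
      Real.log_mul (by positivity) (by positivity)]
    ring
  rw [relEntropy, sum_prob_mul a fun y => Real.log (prob P a y / (μ y / M))] at gibbs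
  simp only [log_ratio, Finset.sum_sub_distrib, Finset.sum_add_distrib, ← Finset.sum_mul, hP₁,
    one_mul] at gibbs
  rw [entropy]
  linarith

theorem entropy_add_entropy_sub_entropy_le_log [Fintype A] (hP₁ : ∑ x, P x = 1) (a : X → A)
    (c : X → Z) {μ : A → ℝ} {M : ℝ} (hM : 0 < M) (hμ₀ : ∀ y, 0 ≤ μ y) (hμ : ∑ y, μ y = M)
    (h : ∀ y z, prob P (fun x => (a x, c x)) (y, z) ≤ μ y * prob P c z) :
    entropy P a + entropy P c - entropy P (fun x => (a x, c x)) ≤ Real.log M := by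
  have μ_pos (x : X) (hx : 0 < P x) : 0 < μ (a x) :=
    pos_of_mul_pos_left ((hx.trans_le (le_prob hP (fun x => (a x, c x)) x)).trans_le (h _ _))
      (prob_nonneg hP c (c x))
  have log_le (x : X) : P x * Real.log (prob P (fun x => (a x, c x)) (a x, c x))
      ≤ P x * Real.log (μ (a x)) + P x * Real.log (prob P c (c x)) := by
    rcases (hP x).eq_or_lt with h0 | h0
    · simp [← h0]
    have ac_pos := h0.trans_le (le_prob hP (fun x => (a x, c x)) x)
    have c_pos := h0.trans_le (le_prob hP c x)
    rw [← mul_add, ← Real.log_mul (μ_pos x h0).ne' c_pos.ne']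
    gcongr
    exact h _ _
  have entropy_le := entropy_add_sum_mul_log_le_log hP hP₁ a hM hμ₀ hμ μ_pos
  have sum_log_le := Finset.sum_le_sum fun x (_ : x ∈ Finset.univ) => log_le x
  rw [Finset.sum_add_distrib] at sum_log_le
  simp only [entropy] at entropy_le ⊢
  linarith

end Information

section Configurations

open Function

variable {V Ω R : Type*} [Fintype V] [DecidableEq V] [Fintype Ω] [CommSemiring R]

theorem sum_mul_prod_two_site {i j : V} (hij : i ≠ j) (f : Ω × Ω → R) (g : V → Ω → R) :
    ∑ x : V → Ω, f (x i, x j) * ∏ v, g v (x v)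
      = (∑ o : Ω × Ω, f o * (g i o.1 * g j o.2)) * ∏ v ∈ ({i, j} : Finset V)ᶜ, ∑ k, g v k := by
  classical
  let s (o : Ω × Ω) : V → Finset Ω := update (update (fun _ => Finset.univ) j {o.2}) i {o.1}
  have filter_eq_piFinset (o : Ω × Ω) :
      Finset.univ.filter (fun x : V → Ω => (x i, x j) = o) = Fintype.piFinset (s o) := by
    ext x
    simp only [Finset.mem_filter, Finset.mem_univ, true_and, Fintype.mem_piFinset, Prod.ext_iff]
    refine ⟨fun hx v => ?_, fun hx => ⟨?_, ?_⟩⟩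
    · rcases eq_or_ne v i with rfl | hi
      · simpa [s] using hx.1
      · rcases eq_or_ne v j with rfl | hj
        · simpa [s, hi] using hx.2
        · simp [s, hi, hj]
    · simpa [s] using hx i
    · simpa [s, hij.symm] using hx j
  have sum_piFinset (o : Ω × Ω) : ∑ x ∈ Fintype.piFinset (s o), ∏ v, g v (x v)
      = g i o.1 * g j o.2 * ∏ v ∈ ({i, j} : Finset V)ᶜ, ∑ k, g v k := by
    rw [← Finset.prod_univ_sum, ← Finset.prod_mul_prod_compl {i, j}, Finset.prod_pair hij]
    congr 1
    · simp [s, hij.symm]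
    · refine Finset.prod_congr rfl fun v hv => ?_
      simp only [Finset.mem_compl, Finset.mem_insert, Finset.mem_singleton, not_or] at hv
      simp [s, hv.1, hv.2]
  rw [← Finset.sum_fiberwise _ fun x : V → Ω => (x i, x j), Finset.sum_mul]
  refine Finset.sum_congr rfl fun o _ => ?_
  rw [mul_assoc, ← sum_piFinset, ← filter_eq_piFinset, Finset.mul_sum]
  exact Finset.sum_congr rfl fun x hx => by rw [(Finset.mem_filter.mp hx).2]

theorem sum_sum_update (F : (V → Ω) → R) (i : V) :
    ∑ x, ∑ o, F (update x i o) = Fintype.card Ω * ∑ x, F x := by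
  let swap (p : (V → Ω) × Ω) : (V → Ω) × Ω := (update p.1 i p.2, p.1 i)
  have swap_involutive : Involutive swap := fun p => by simp [swap]
  calc ∑ x, ∑ o, F (update x i o)
      = ∑ p : (V → Ω) × Ω, F p.1 := by
        rw [← Fintype.sum_prod_type']
        exact Equiv.sum_comp swap_involutive.toPerm fun p : (V → Ω) × Ω => F p.1
    _ = Fintype.card Ω * ∑ x, F x := by
        simp [Fintype.sum_prod_type, Finset.mul_sum, nsmul_eq_mul]

/-- The configuration `y` with its values at the sites `i` and `j` replaced by `p`. -/
def setPair (y : V → Ω) (i j : V) (p : Ω × Ω) : V → Ω := update (update y j p.2) i p.1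

omit [Fintype V] [Fintype Ω] in
theorem setPair_apply_left (y : V → Ω) (i j : V) (p : Ω × Ω) : setPair y i j p i = p.1 :=
  update_self ..

omit [Fintype V] [Fintype Ω] in
theorem setPair_apply_right (y : V → Ω) {i j : V} (hij : i ≠ j) (p : Ω × Ω) :
    setPair y i j p j = p.2 := by
  simp [setPair, hij.symm]

omit [Fintype V] [Fintype Ω] in
theorem setPair_apply_of_ne (y : V → Ω) {i j v : V} (hi : v ≠ i) (hj : v ≠ j) (p : Ω × Ω) :
    setPair y i j p v = y v := by
  simp [setPair, hi, hj]

omit [Fintype V] [Fintype Ω] in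
theorem setPair_injective (y : V → Ω) {i j : V} (hij : i ≠ j) :
    Injective (setPair y i j) := fun p q h => by
  ext
  · simpa only [setPair_apply_left] using congrFun h i
  · simpa only [setPair_apply_right y hij] using congrFun h j

omit [Fintype V] [Fintype Ω] in
theorem setPair_of_forall_eq {i j : V} {x y : V → Ω} (h : ∀ v, v ≠ i → v ≠ j → y v = x v) :
    setPair y i j (x i, x j) = x := by
  simp only [setPair, update_eq_iff, true_and]
  refine fun v hi => ?_
  rcases eq_or_ne v j with rfl | hj
  · simp
  · simp [hj, h v hi hj]

omit [Fintype V] [Fintype Ω] in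
theorem setPair_setPair (y : V → Ω) (i j : V) (p q : Ω × Ω) :
    setPair (setPair y i j p) i j q = setPair y i j q := by
  ext v
  by_cases hi : v = i <;> by_cases hj : v = j <;> simp [setPair, update_apply, hi, hj]

theorem sum_sum_setPair (F : (V → Ω) → R) (i j : V) :
    ∑ y, ∑ p, F (setPair y i j p) = Fintype.card Ω ^ 2 * ∑ y, F y := by
  calc ∑ y, ∑ p, F (setPair y i j p)
      = ∑ y, ∑ o', ∑ o, F (update (update y j o') i o) := by
        simp only [Fintype.sum_prod_type_right, setPair]
    _ = Fintype.card Ω ^ 2 * ∑ y, F y := by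
        rw [sum_sum_update (fun y => ∑ o, F (update y i o)), sum_sum_update, sq, mul_assoc]

end Configurations

section QuadForm

open Matrix

variable {κ : Type*} [Fintype κ]

/-- The quadratic form `⟨ψ|H|ψ⟩` (its real part; it is real when `H` is Hermitian). -/
def quadForm (H : Matrix κ κ ℂ) (ψ : κ → ℂ) : ℝ := (star ψ ⬝ᵥ H *ᵥ ψ).re

theorem abs_quadForm_le {A : Matrix κ κ ℂ} (hA : IsContraction A) (ψ : κ → ℂ) :
    |quadForm A ψ| ≤ ∑ y, ‖ψ y‖ ^ 2 := by
  refine (Complex.abs_re_le_norm _).trans (le_of_sq_le_sq ?_ (by positivity))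
  refine (norm_sq_star_dotProduct_le ψ (A *ᵥ ψ)).trans ?_
  rw [sq]
  exact mul_le_mul_of_nonneg_left (hA ψ) (by positivity)

theorem quadForm_sum_smul_vecMulVec {Ω : Type*} [Fintype Ω] (c : Ω → ℝ) (u : Ω → κ → ℂ)
    (ψ : κ → ℂ) :
    quadForm (∑ o, (c o : ℂ) • vecMulVec (u o) (star (u o))) ψ
      = ∑ o, c o * ‖star (u o) ⬝ᵥ ψ‖ ^ 2 := by
  simp only [quadForm, sum_mulVec, dotProduct_sum, smul_mulVec, dotProduct_smul,
    star_dotProduct_vecMulVec_self_mulVec, smul_eq_mul, ← Complex.ofReal_mul,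
    ← Complex.ofReal_sum, Complex.ofReal_re]

theorem IsContraction.submatrix {ι : Type*} [Fintype ι] {A : Matrix κ κ ℂ} (hA : IsContraction A)
    {e : ι → κ} (he : e.Injective) : IsContraction (A.submatrix e e) := by
  intro φ
  have extend_apply_of_notMem {y : κ} (hy : y ∉ Set.range e) : Function.extend e φ 0 y = 0 := by
    rw [Function.extend_apply' _ _ _ hy, Pi.zero_apply]
  have submatrix_mulVec (a : ι) :
      (A.submatrix e e *ᵥ φ) a = (A *ᵥ Function.extend e φ 0) (e a) := by
    simp only [mulVec, dotProduct]
    exact Fintype.sum_of_injective e he _ _ (fun y hy => by simp [extend_apply_of_notMem hy])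
      fun b => by rw [he.extend_apply, submatrix_apply]
  calc ∑ a, ‖(A.submatrix e e *ᵥ φ) a‖ ^ 2
      = ∑ a, ‖(A *ᵥ Function.extend e φ 0) (e a)‖ ^ 2 := by simp only [submatrix_mulVec]
    _ ≤ ∑ y, ‖(A *ᵥ Function.extend e φ 0) y‖ ^ 2 :=
        (Finset.sum_map Finset.univ ⟨e, he⟩ fun y =>
          ‖(A *ᵥ Function.extend e φ 0) y‖ ^ 2).symm.trans_le
          (Finset.sum_le_univ_sum_of_nonneg fun y => by positivity)
    _ ≤ ∑ y, ‖Function.extend e φ 0 y‖ ^ 2 := hA _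
    _ = ∑ a, ‖φ a‖ ^ 2 :=
        (Fintype.sum_of_injective e he _ _ (fun y hy => by simp [extend_apply_of_notMem hy])
          fun a => by rw [he.extend_apply]).symm

end QuadForm

section PairOperators

open Matrix

variable {V ι : Type*}

open Classical in
/-- The operator `K ⊗ I`, where `K` acts on the sites `i` and `j` and `I` on the other sites. -/
noncomputable def pairLift (i j : V) (K : Matrix (ι × ι) (ι × ι) ℂ) :
    Matrix (V → ι) (V → ι) ℂ :=
  Matrix.of fun y y' =>
    if ∀ v, v ≠ i → v ≠ j → y v = y' v then K (y i, y j) (y' i, y' j) else 0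

theorem ActsOnlyOn.eq_pairLift [DecidableEq V] {d : ℕ} {i j : V} (hij : i ≠ j) {A : QuditOp V d}
    (hA : ActsOnlyOn {v | v ∈ s(i, j)} A) (y : V → Fin d) :
    A = pairLift i j (A.submatrix (setPair y i j) (setPair y i j)) := by
  obtain ⟨K, hK⟩ := hA
  have restrict_setPair (x : V → Fin d) :
      (fun v : {v | v ∈ s(i, j)} => setPair y i j (x i, x j) v.1) = fun v => x v.1 := by
    ext ⟨v, hv⟩
    rcases Sym2.mem_iff.mp hv with rfl | rfl
    · simp [setPair_apply_left]
    · simp [setPair_apply_right y hij]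
  have outside_iff (x x' : V → Fin d) : (∀ v, v ∉ {v | v ∈ s(i, j)} → x v = x' v) ↔
      ∀ v, v ≠ i → v ≠ j → x v = x' v := by
    simp [not_or, and_imp]
  have setPair_agree (x x' : V → Fin d) : ∀ v, v ∉ {v | v ∈ s(i, j)} →
      setPair y i j (x i, x j) v = setPair y i j (x' i, x' j) v :=
    (outside_iff _ _).mpr fun v hi hj => by
      rw [setPair_apply_of_ne y hi hj, setPair_apply_of_ne y hi hj]
  ext x x'
  rw [pairLift, of_apply, submatrix_apply, hK, hK, if_pos (setPair_agree x x'), restrict_setPair,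
    restrict_setPair]
  classical exact if_congr (outside_iff x x') rfl rfl

variable [Fintype V] [DecidableEq V] {i j : V} (hij : i ≠ j)

include hij

variable [Fintype ι]

theorem pairLift_mulVec (K : Matrix (ι × ι) (ι × ι) ℂ) (ψ : (V → ι) → ℂ) (y : V → ι) :
    (pairLift i j K *ᵥ ψ) y = (K *ᵥ fun p => ψ (setPair y i j p)) (y i, y j) := by
  simp only [mulVec, dotProduct]
  refine (Fintype.sum_of_injective (setPair y i j) (setPair_injective y hij) _ _
    (fun x hx => ?_) fun p => ?_).symm
  · have not_agree : ¬∀ v, v ≠ i → v ≠ j → y v = x v := fun h =>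
      hx ⟨_, setPair_of_forall_eq h⟩
    rw [pairLift, of_apply, if_neg not_agree, zero_mul]
  · rw [pairLift, of_apply, if_pos fun v hi hj => (setPair_apply_of_ne y hi hj p).symm,
      setPair_apply_left, setPair_apply_right y hij]

theorem card_sq_mul_quadForm_pairLift (K : Matrix (ι × ι) (ι × ι) ℂ) (ψ : (V → ι) → ℂ) :
    Fintype.card ι ^ 2 * quadForm (pairLift i j K) ψ
      = ∑ y, quadForm K fun p => ψ (setPair y i j p) := by
  have mulVec_slice (y : V → ι) (p : ι × ι) : (K *ᵥ fun q => ψ (setPair y i j q)) p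
      = (pairLift i j K *ᵥ ψ) (setPair y i j p) := by
    simp only [pairLift_mulVec hij, setPair_setPair, setPair_apply_left, setPair_apply_right y hij]
  simp only [quadForm, dotProduct, Pi.star_apply, mulVec_slice, Complex.re_sum]
  exact (sum_sum_setPair (fun y => (star (ψ y) * (pairLift i j K *ᵥ ψ) y).re) i j).symm

theorem quadForm_pairLift_le [Nonempty ι] {K : Matrix (ι × ι) (ι × ι) ℂ} {S : ℝ}
    (hK : ∀ χ, quadForm K χ ≤ S * ∑ p, ‖χ p‖ ^ 2) (ψ : (V → ι) → ℂ) :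
    quadForm (pairLift i j K) ψ ≤ S * ∑ y, ‖ψ y‖ ^ 2 := by
  have card_pos : (0 : ℝ) < Fintype.card ι ^ 2 := by
    have := Fintype.card_pos (α := ι)
    positivity
  refine le_of_mul_le_mul_left ?_ card_pos
  rw [card_sq_mul_quadForm_pairLift hij, mul_left_comm, ← sum_sum_setPair _ i j, Finset.mul_sum]
  exact Finset.sum_le_sum fun y _ => hK _

end PairOperators

section PairMeasurements

open Matrix ComplexConjugate

variable {V ι Ω : Type*} [Fintype V] [DecidableEq V] {i j : V} (hij : i ≠ j)
  [Fintype Ω] [DecidableEq ι] {m : Ω → ι → ℂ} (hm : IsParsevalFrame m)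

include hij hm

theorem IsParsevalFrame.pairLift_sum_smul_vecMulVec (h : Ω × Ω → ℂ) :
    pairLift i j (∑ o, h o • vecMulVec (tensorVec (m o.1) (m o.2))
        (star (tensorVec (m o.1) (m o.2))))
      = ∑ x : V → Ω, h (x i, x j) •
          vecMulVec (piTensorVec (m ∘ x)) (star (piTensorVec (m ∘ x))) := by
  rw [isParsevalFrame_iff] at hm
  ext y y'
  have factors (x : V → Ω) : vecMulVec (piTensorVec (m ∘ x)) (star (piTensorVec (m ∘ x))) y y'
      = ∏ v, m (x v) (y v) * conj (m (x v) (y' v)) := by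
    simp [vecMulVec_apply, piTensorVec, Finset.prod_mul_distrib]
  simp only [Matrix.sum_apply, Matrix.smul_apply, factors, smul_eq_mul]
  rw [sum_mul_prod_two_site hij h fun v k => m k (y v) * conj (m k (y' v))]
  simp only [hm, one_apply, Finset.prod_ite_zero, Finset.prod_const_one, mul_ite, mul_one,
    mul_zero, Finset.mem_compl, Finset.mem_insert, Finset.mem_singleton, not_or, and_imp,
    pairLift, of_apply, Matrix.sum_apply, Matrix.smul_apply, smul_eq_mul, vecMulVec_apply,
    tensorVec, Pi.star_apply, star_mul', RCLike.star_def, mul_mul_mul_comm]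

variable [Fintype ι]

theorem IsParsevalFrame.quadForm_pairLift (h : Ω × Ω → ℝ) (ψ : (V → ι) → ℂ) :
    quadForm (pairLift i j (∑ o, (h o : ℂ) • vecMulVec (tensorVec (m o.1) (m o.2))
        (star (tensorVec (m o.1) (m o.2))))) ψ
      = ∑ x : V → Ω, h (x i, x j) * ‖star (piTensorVec (m ∘ x)) ⬝ᵥ ψ‖ ^ 2 := by
  rw [hm.pairLift_sum_smul_vecMulVec hij]
  exact quadForm_sum_smul_vecMulVec (fun x : V → Ω => h (x i, x j)) _ ψ

theorem IsParsevalFrame.sum_mul_norm_sq_le [Nonempty ι] {g : Ω × Ω → ℝ} {S : ℝ}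
    (hg : ∀ χ, ∑ o, g o * ‖star (tensorVec (m o.1) (m o.2)) ⬝ᵥ χ‖ ^ 2 ≤ S * ∑ p, ‖χ p‖ ^ 2)
    (ψ : (V → ι) → ℂ) :
    ∑ x : V → Ω, g (x i, x j) * ‖star (piTensorVec (m ∘ x)) ⬝ᵥ ψ‖ ^ 2
      ≤ S * ∑ y, ‖ψ y‖ ^ 2 := by
  rw [← hm.quadForm_pairLift hij]
  refine quadForm_pairLift_le hij (fun χ => ?_) ψ
  rw [quadForm_sum_smul_vecMulVec]
  exact hg χ

end PairMeasurements

section ProductVectors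

open Function Matrix

variable {V ι Ω : Type*} [Fintype V] [DecidableEq V] [Fintype ι]

theorem star_piTensorVec_dotProduct (f φ : V → ι → ℂ) :
    star (piTensorVec f) ⬝ᵥ piTensorVec φ = ∏ v, star (f v) ⬝ᵥ φ v := by
  simp only [dotProduct, Fintype.prod_sum, piTensorVec, Pi.star_apply, star_prod,
    Finset.prod_mul_distrib]

theorem sum_norm_sq_piTensorVec (φ : V → ι → ℂ) :
    ∑ y, ‖piTensorVec φ y‖ ^ 2 = ∏ v, ∑ a, ‖φ v a‖ ^ 2 := by
  simp only [Fintype.prod_sum, piTensorVec, norm_prod, Finset.prod_pow]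

theorem IsParsevalFrame.quadForm_pairLift_piTensorVec [DecidableEq ι] [Fintype Ω] {m : Ω → ι → ℂ}
    (hm : IsParsevalFrame m) {i j : V} (hij : i ≠ j) (h : Ω × Ω → ℝ) {φ : V → ι → ℂ}
    (hφ : ∀ v, ∑ a, ‖φ v a‖ ^ 2 = 1) :
    quadForm (pairLift i j (∑ o, (h o : ℂ) • vecMulVec (tensorVec (m o.1) (m o.2))
        (star (tensorVec (m o.1) (m o.2))))) (piTensorVec φ)
      = ∑ o, h o * (‖star (m o.1) ⬝ᵥ φ i‖ ^ 2 * ‖star (m o.2) ⬝ᵥ φ j‖ ^ 2) := by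
  rw [hm.quadForm_pairLift hij]
  simp only [star_piTensorVec_dotProduct, norm_prod, ← Finset.prod_pow, Function.comp_apply]
  rw [sum_mul_prod_two_site hij h fun v k => ‖star (m k) ⬝ᵥ φ v‖ ^ 2]
  simp only [hm.sum_norm_sq_dotProduct, hφ, Finset.prod_const_one, mul_one]

omit [Fintype ι] in
theorem piTensorVec_update (φ : V → ι → ℂ) (i : V) (u : ι → ℂ) (y : V → ι) :
    piTensorVec (update φ i u) y = u (y i) * ∏ v ∈ Finset.univ \ {i}, φ v (y v) := by
  simp only [piTensorVec, apply_update fun v (f : ι → ℂ) => f (y v)]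
  exact Finset.prod_update_of_mem (Finset.mem_univ i) ..

variable [DecidableEq ι]

/-- The partial inner product of `ψ` with `⊗_{v ≠ i} φ_v`: the unnormalised state of the site `i`
after the other sites have been found in the states `φ_v`. -/
def siteState (φ : V → ι → ℂ) (ψ : (V → ι) → ℂ) (i : V) (a : ι) : ℂ :=
  star (piTensorVec (update φ i (Pi.single a 1))) ⬝ᵥ ψ

theorem star_piTensorVec_update_dotProduct (φ : V → ι → ℂ) (ψ : (V → ι) → ℂ) (i : V)
    (u : ι → ℂ) : star (piTensorVec (update φ i u)) ⬝ᵥ ψ = star u ⬝ᵥ siteState φ ψ i := by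
  have expand : piTensorVec (update φ i u)
      = ∑ a, u a • piTensorVec (update φ i (Pi.single a 1)) := by
    ext y
    simp [piTensorVec_update, Pi.single_apply]
  simp only [expand, star_sum, star_smul, sum_dotProduct, smul_dotProduct, smul_eq_mul]
  rfl

theorem siteState_update (φ : V → ι → ℂ) (ψ : (V → ι) → ℂ) (i : V) (u : ι → ℂ) :
    siteState (update φ i u) ψ i = siteState φ ψ i := by
  ext a
  rw [siteState, siteState, update_idem]

end ProductVectors

section ConditionalResampling

variable {V X Z : Type*} [Fintype V] [DecidableEq V] [Fintype X] [Fintype Z]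

/-- The mean of `F κ` when `z` is drawn from the distribution of `c` under the weights `P`, and the
`κ v` are then drawn independently of each other from `P` conditioned on `c = z`. -/
noncomputable def resampledMean (P : X → ℝ) (c : X → Z) (F : (V → X) → ℝ) : ℝ :=
  ∑ z, ∑ κ : V → X, prob P c z * (∏ v, condWeight P c z (κ v)) * F κ

theorem resampledMean_sum {I : Type*} (P : X → ℝ) (c : X → Z) (s : Finset I)
    (F : I → (V → X) → ℝ) :
    resampledMean P c (fun κ => ∑ e ∈ s, F e κ) = ∑ e ∈ s, resampledMean P c (F e) := by
  simp only [resampledMean, Finset.mul_sum]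
  rw [Finset.sum_congr rfl fun z _ => Finset.sum_comm, Finset.sum_comm]

theorem resampledMean_const_mul (P : X → ℝ) (c : X → Z) (r : ℝ) (F : (V → X) → ℝ) :
    resampledMean P c (fun κ => r * F κ) = r * resampledMean P c F := by
  simp only [resampledMean, Finset.mul_sum, mul_left_comm r]

theorem resampledMean_mul (P : X → ℝ) (c : X → Z) {i j : V} (hij : i ≠ j) (f g : X → ℝ) :
    resampledMean P c (fun κ => f (κ i) * g (κ j))
      = ∑ z, prob P c z * ((∑ x, condWeight P c z x * f x) * ∑ x, condWeight P c z x * g x) := by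
  refine Finset.sum_congr rfl fun z _ => ?_
  rcases eq_or_ne (prob P c z) 0 with hz | hz
  · simp [hz]
  simp only [mul_assoc, ← Finset.mul_sum]
  congr 1
  rw [Finset.sum_congr rfl fun κ _ => mul_comm _ _,
    sum_mul_prod_two_site hij (fun p => f p.1 * g p.2) fun _ => condWeight P c z]
  simp only [sum_condWeight hz, Finset.prod_const_one, one_mul, Finset.sum_mul_sum,
    Fintype.sum_prod_type, mul_comm, mul_left_comm]

variable {P : X → ℝ}

theorem resampledMean_const (hP₁ : ∑ x, P x = 1) (c : X → Z) (r : ℝ) :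
    resampledMean P c (fun _ : V → X => r) = r := by
  have sum_weights (z : Z) :
      ∑ κ : V → X, prob P c z * ∏ v, condWeight P c z (κ v) = prob P c z := by
    rcases eq_or_ne (prob P c z) 0 with hz | hz
    · simp [hz]
    · rw [← Finset.mul_sum, ← Fintype.prod_sum fun _ => condWeight P c z]
      simp [sum_condWeight hz]
  simp only [resampledMean, ← Finset.sum_mul, sum_weights, sum_prob, hP₁, one_mul]

theorem resampledMean_mono (hP : ∀ x, 0 ≤ P x) (c : X → Z) {F F' : (V → X) → ℝ}
    (h : ∀ κ, F κ ≤ F' κ) : resampledMean P c F ≤ resampledMean P c F' :=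
  Finset.sum_le_sum fun z _ => Finset.sum_le_sum fun κ _ =>
    mul_le_mul_of_nonneg_left (h κ) (mul_nonneg (prob_nonneg hP c z)
      (Finset.prod_nonneg fun v _ => condWeight_nonneg hP c z (κ v)))

theorem exists_le_resampledMean (hP : ∀ x, 0 ≤ P x) (hP₁ : ∑ x, P x = 1) (c : X → Z)
    (F : (V → X) → ℝ) : ∃ κ, F κ ≤ resampledMean P c F := by
  have : Nonempty X := by
    by_contra! hX
    simp at hP₁
  obtain ⟨κ, hκ⟩ := Finite.exists_min F
  exact ⟨κ, (resampledMean_const hP₁ c (F κ)).symm.trans_le (resampledMean_mono hP c hκ)⟩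

end ConditionalResampling

section Normalization

open Matrix

variable {ι : Type*} [Fintype ι] [Nonempty ι]

theorem exists_eq_sqrt_sum_norm_sq_smul (φ : ι → ℂ) :
    ∃ u : ι → ℂ, ∑ a, ‖u a‖ ^ 2 = 1 ∧ φ = (√(∑ a, ‖φ a‖ ^ 2) : ℂ) • u := by
  classical
  set N := ∑ a, ‖φ a‖ ^ 2 with hN
  have N_nonneg : 0 ≤ N := by positivity
  rcases eq_or_ne N 0 with h | h
  · have φ_eq_zero : φ = 0 := by
      ext a
      simpa using (Finset.sum_eq_zero_iff_of_nonneg fun a _ => sq_nonneg ‖φ a‖).mp (hN ▸ h) a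
        (Finset.mem_univ a)
    refine ⟨Pi.single (Classical.arbitrary ι) 1, ?_, by simp [h, φ_eq_zero]⟩
    simp [Pi.single_apply, apply_ite norm, ite_pow]
  · refine ⟨(√N : ℂ)⁻¹ • φ, ?_, ?_⟩
    · simp only [Pi.smul_apply, smul_eq_mul, norm_mul, norm_inv, mul_pow, ← Finset.mul_sum, ← hN,
        Complex.norm_real, Real.norm_eq_abs, inv_pow, sq_abs, Real.sq_sqrt N_nonneg]
      exact inv_mul_cancel₀ h
    · rw [smul_inv_smul₀ (by simpa [Real.sqrt_eq_zero N_nonneg] using h)]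

/-- A unit vector `u` with `φ = ‖φ‖ u`; it is arbitrary if `φ = 0`. -/
noncomputable def unitVec (φ : ι → ℂ) : ι → ℂ := (exists_eq_sqrt_sum_norm_sq_smul φ).choose

theorem sum_norm_sq_unitVec (φ : ι → ℂ) : ∑ a, ‖unitVec φ a‖ ^ 2 = 1 :=
  (exists_eq_sqrt_sum_norm_sq_smul φ).choose_spec.1

theorem sum_norm_sq_mul_norm_sq_dotProduct_unitVec (φ v : ι → ℂ) :
    (∑ a, ‖φ a‖ ^ 2) * ‖v ⬝ᵥ unitVec φ‖ ^ 2 = ‖v ⬝ᵥ φ‖ ^ 2 := by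
  have φ_eq : φ = (√(∑ a, ‖φ a‖ ^ 2) : ℂ) • unitVec φ :=
    (exists_eq_sqrt_sum_norm_sq_smul φ).choose_spec.2
  conv_rhs => rw [φ_eq, dotProduct_smul, smul_eq_mul, norm_mul, mul_pow, Complex.norm_real,
    Real.norm_eq_abs, sq_abs, Real.sq_sqrt (by positivity)]

end Normalization

section Measurement

open Function Matrix

variable {V ι Ω : Type*} [Fintype V] [DecidableEq V] [Fintype ι] {m : Ω → ι → ℂ}

/-- The probability of the outcomes `x` when every site of `ψ` is measured with `m`. -/
noncomputable def outcomeProb (m : Ω → ι → ℂ) (ψ : (V → ι) → ℂ) (x : V → Ω) : ℝ :=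
  ‖star (piTensorVec (m ∘ x)) ⬝ᵥ ψ‖ ^ 2

theorem outcomeProb_nonneg (m : Ω → ι → ℂ) (ψ : (V → ι) → ℂ) (x : V → Ω) :
    0 ≤ outcomeProb m ψ x :=
  sq_nonneg _

theorem outcomeProb_update [DecidableEq ι] (m : Ω → ι → ℂ) (ψ : (V → ι) → ℂ) (x : V → Ω) (i : V)
    (o : Ω) : outcomeProb m ψ (update x i o) = ‖star (m o) ⬝ᵥ siteState (m ∘ x) ψ i‖ ^ 2 := by
  rw [outcomeProb, comp_update, star_piTensorVec_update_dotProduct]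

variable [Fintype Ω]

omit [Fintype ι] in
theorem card_mul_prob_restrict (F : (V → Ω) → ℝ) {C : Finset V} {i : V} (hi : i ∉ C) (z : C → Ω) :
    Fintype.card Ω * prob F C.restrict z
      = prob (fun x => ∑ o, F (update x i o)) C.restrict z := by
  classical
  have restrict_update (x : V → Ω) (o : Ω) : C.restrict (update x i o) = C.restrict x := by
    ext v
    exact update_of_ne (ne_of_mem_of_not_mem v.2 hi) o x
  rw [prob, ← sum_sum_update _ i]
  refine Finset.sum_congr rfl fun x _ => ?_
  simp only [restrict_update]
  split_ifs <;> simp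

variable [DecidableEq ι]

theorem IsParsevalFrame.sum_outcomeProb (hm : IsParsevalFrame m) (ψ : (V → ι) → ℂ) :
    ∑ x, outcomeProb m ψ x = ∑ y, ‖ψ y‖ ^ 2 :=
  (IsParsevalFrame.pi fun _ : V => hm).sum_norm_sq_dotProduct ψ

variable (ψ : (V → ι) → ℂ) {C : Finset V} {i : V} (hi : i ∉ C) (o : Ω) (z : C → Ω)

include hi

theorem card_mul_prob_prodMk_restrict (m : Ω → ι → ℂ) :
    Fintype.card Ω * prob (outcomeProb m ψ) (fun x => (x i, C.restrict x)) (o, z)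
      = prob (fun x => ‖star (m o) ⬝ᵥ siteState (m ∘ x) ψ i‖ ^ 2) C.restrict z := by
  classical
  have split_event : prob (outcomeProb m ψ) (fun x => (x i, C.restrict x)) (o, z)
      = prob (fun x => if x i = o then outcomeProb m ψ x else 0) C.restrict z := by
    refine Finset.sum_congr rfl fun x _ => ?_
    by_cases hz : C.restrict x = z <;> by_cases ho : x i = o <;> simp [hz, ho]
  rw [split_event, card_mul_prob_restrict _ hi]
  simp only [update_self, Finset.sum_ite_eq', Finset.mem_univ, if_true, outcomeProb_update]

namespace IsParsevalFrame

variable (hm : IsParsevalFrame m)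

include hm

theorem prob_prodMk_restrict_le :
    prob (outcomeProb m ψ) (fun x => (x i, C.restrict x)) (o, z)
      ≤ (∑ a, ‖m o a‖ ^ 2) * prob (outcomeProb m ψ) C.restrict z := by
  have card_pos : (0 : ℝ) < Fintype.card Ω := by
    exact_mod_cast Fintype.card_pos_iff.mpr ⟨o⟩
  refine le_of_mul_le_mul_left ?_ card_pos
  rw [card_mul_prob_prodMk_restrict ψ hi, mul_left_comm, card_mul_prob_restrict _ hi]
  simp only [outcomeProb_update, hm.sum_norm_sq_dotProduct, prob]
  rw [Finset.mul_sum]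
  refine Finset.sum_le_sum fun x _ => ?_
  split_ifs
  · exact norm_sq_star_dotProduct_le _ _
  · rw [mul_zero]

theorem sum_condWeight_mul_norm_sq_unitVec [Nonempty ι] :
    ∑ x : V → Ω, condWeight (outcomeProb m ψ) C.restrict z x
        * ‖star (m o) ⬝ᵥ unitVec (siteState (m ∘ x) ψ i)‖ ^ 2
      = prob (outcomeProb m ψ) (fun x => (x i, C.restrict x)) (o, z)
        / prob (outcomeProb m ψ) C.restrict z := by
  have card_ne_zero : (Fintype.card Ω : ℝ) ≠ 0 := by
    exact_mod_cast (Fintype.card_pos_iff.mpr ⟨o⟩).ne'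
  rw [sum_condWeight_mul]
  congr 1
  refine mul_left_cancel₀ card_ne_zero ?_
  rw [card_mul_prob_prodMk_restrict ψ hi, card_mul_prob_restrict _ hi]
  simp only [comp_update, siteState_update, ← Finset.sum_mul, outcomeProb_update,
    hm.sum_norm_sq_dotProduct, sum_norm_sq_mul_norm_sq_dotProduct_unitVec]

end IsParsevalFrame

end Measurement

section Resampling

open Matrix

variable {V ι Ω : Type*} [Fintype V] [DecidableEq V] [Fintype ι] [DecidableEq ι] [Nonempty ι]
  [Fintype Ω] {m : Ω → ι → ℂ}

/-- The product state whose factor at the site `v` is the state of `v` after the other sites have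
been found in the states `m (κ v u)`, `u ≠ v`; every site has its own outcomes `κ v`. -/
noncomputable def resampledState (m : Ω → ι → ℂ) (ψ : (V → ι) → ℂ) (κ : V → V → Ω) (v : V) :
    ι → ℂ :=
  unitVec (siteState (m ∘ κ v) ψ v)

omit [Fintype Ω] in
theorem sum_norm_sq_piTensorVec_resampledState (m : Ω → ι → ℂ) (ψ : (V → ι) → ℂ)
    (κ : V → V → Ω) : ∑ y, ‖piTensorVec (resampledState m ψ κ) y‖ ^ 2 = 1 := by
  simp only [sum_norm_sq_piTensorVec, resampledState, sum_norm_sq_unitVec, Finset.prod_const_one]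

theorem IsParsevalFrame.resampledMean_two_site (hm : IsParsevalFrame m) (ψ : (V → ι) → ℂ)
    {C : Finset V} {i j : V} (hij : i ≠ j) (hi : i ∉ C) (hj : j ∉ C) (g : Ω × Ω → ℝ) :
    resampledMean (outcomeProb m ψ) C.restrict (fun κ => ∑ o, g o
        * (‖star (m o.1) ⬝ᵥ resampledState m ψ κ i‖ ^ 2
          * ‖star (m o.2) ⬝ᵥ resampledState m ψ κ j‖ ^ 2))
      = ∑ t, condProd (outcomeProb m ψ) (fun x => x i) (fun x => x j) C.restrict t
          * g (t.1, t.2.1) := by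
  have mean_single (o : Ω × Ω) : resampledMean (outcomeProb m ψ) C.restrict (fun κ =>
        ‖star (m o.1) ⬝ᵥ resampledState m ψ κ i‖ ^ 2
          * ‖star (m o.2) ⬝ᵥ resampledState m ψ κ j‖ ^ 2)
      = ∑ z, condProd (outcomeProb m ψ) (fun x => x i) (fun x => x j) C.restrict (o.1, o.2, z) := by
    refine (resampledMean_mul _ _ hij
      (fun x => ‖star (m o.1) ⬝ᵥ unitVec (siteState (m ∘ x) ψ i)‖ ^ 2)
      fun x => ‖star (m o.2) ⬝ᵥ unitVec (siteState (m ∘ x) ψ j)‖ ^ 2).trans ?_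
    simp only [hm.sum_condWeight_mul_norm_sq_unitVec ψ hi,
      hm.sum_condWeight_mul_norm_sq_unitVec ψ hj]
    refine Finset.sum_congr rfl fun z _ => ?_
    rcases eq_or_ne (prob (outcomeProb m ψ) C.restrict z) 0 with hz | hz
    · simp [condProd, hz]
    · rw [condProd]
      field_simp
  rw [resampledMean_sum]
  simp only [resampledMean_const_mul, mean_single, Fintype.sum_prod_type, Finset.mul_sum,
    mul_comm]

theorem HasDistortion.resampledMean_quadForm_le (hm : IsParsevalFrame m) {S : ℝ}
    (hS : HasDistortion m S) {ψ : (V → ι) → ℂ} (hψ : ∑ y, ‖ψ y‖ ^ 2 = 1) {C : Finset V} {i j : V}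
    (hij : i ≠ j) (hi : i ∉ C) (hj : j ∉ C) {K : Matrix (ι × ι) (ι × ι) ℂ} (hK : K.IsHermitian)
    (hK₁ : IsContraction K) :
    resampledMean (outcomeProb m ψ) C.restrict
        (fun κ => quadForm (pairLift i j K) (piTensorVec (resampledState m ψ κ)))
      ≤ quadForm (pairLift i j K) ψ + √(4 * S
        * condMutualInfo (outcomeProb m ψ) (fun x => x i) (fun x => x j) C.restrict) := by
  obtain ⟨h, rfl, h_sq⟩ := hS K hK hK₁
  have state_unit (κ : V → V → Ω) (v : V) : ∑ a, ‖resampledState m ψ κ v a‖ ^ 2 = 1 :=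
    sum_norm_sq_unitVec _
  have joint_second_moment : ∑ x : V → Ω, outcomeProb m ψ x * h (x i, x j) ^ 2 ≤ S := by
    simpa only [outcomeProb, hψ, mul_one, mul_comm] using hm.sum_mul_norm_sq_le hij h_sq ψ
  have product_second_moment : ∑ t, condProd (outcomeProb m ψ) (fun x => x i) (fun x => x j)
      C.restrict t * h (t.1, t.2.1) ^ 2 ≤ S := by
    rw [← hm.resampledMean_two_site ψ hij hi hj fun o => h o ^ 2]
    refine (resampledMean_mono (outcomeProb_nonneg m ψ) _ fun κ => ?_).trans
      (resampledMean_const ((hm.sum_outcomeProb ψ).trans hψ) _ S).le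
    have := h_sq (tensorVec (resampledState m ψ κ i) (resampledState m ψ κ j))
    simpa only [star_tensorVec_dotProduct_tensorVec, norm_mul, mul_pow, sum_norm_sq_tensorVec,
      state_unit, mul_one] using this
  have gap := sum_condProd_sub_le_sqrt_condMutualInfo (outcomeProb_nonneg m ψ) (fun x => x i)
    (fun x => x j) C.restrict (fun t => h (t.1, t.2.1)) joint_second_moment product_second_moment
  rw [hm.quadForm_pairLift hij]
  simp only [hm.quadForm_pairLift_piTensorVec hij h (state_unit _)]
  rw [hm.resampledMean_two_site ψ hij hi hj h]
  simpa only [outcomeProb, mul_comm, sub_le_iff_le_add'] using gap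

end Resampling

section Chain

variable {V : Type*}

theorem exists_chain [DecidableEq V] {Φ J : Finset V → ℝ}
    (h : ∀ C, ∃ v, J C ≤ Φ (insert v C) - Φ C) :
    ∃ C : ℕ → Finset V, (∀ k, (C k).card ≤ k) ∧
      ∀ n, ∑ k ∈ Finset.range n, J (C k) ≤ Φ (C n) - Φ ∅ := by
  choose next h_next using h
  refine ⟨fun k => k.rec ∅ fun _ C => insert (next C) C, fun k => ?_, fun n => ?_⟩
  · induction k with
    | zero => simp
    | succ k ih => exact (Finset.card_insert_le _ _).trans (Nat.succ_le_succ ih)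
  · induction n with
    | zero => simp
    | succ n ih =>
      rw [Finset.sum_range_succ]
      exact (add_le_add ih (h_next _)).trans_eq (sub_add_sub_cancel' _ _ _)

theorem two_mul_sum_edgeFinset_le [Fintype V] (G : SimpleGraph V) [DecidableRel G.Adj]
    {g : Sym2 V → ℝ} {F : V → V → ℝ} (hF : ∀ i v, 0 ≤ F i v)
    (h : ∀ i v, G.Adj i v → g s(i, v) ≤ F i v) :
    2 * ∑ e ∈ G.edgeFinset, g e ≤ ∑ i, ∑ v, F i v := by
  classical
  have sum_darts : ∑ a : G.Dart, g a.edge = 2 * ∑ e ∈ G.edgeFinset, g e := by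
    rw [← Finset.sum_fiberwise_of_maps_to (t := G.edgeFinset) (g := SimpleGraph.Dart.edge)
      fun a _ => SimpleGraph.mem_edgeFinset.mpr a.edge_mem, Finset.mul_sum]
    refine Finset.sum_congr rfl fun e he => ?_
    rw [Finset.sum_congr rfl fun a ha => congrArg g (Finset.mem_filter.mp ha).2, Finset.sum_const,
      G.dart_edge_fiber_card e (SimpleGraph.mem_edgeFinset.mp he), nsmul_eq_mul, Nat.cast_ofNat]
  calc 2 * ∑ e ∈ G.edgeFinset, g e = ∑ a : G.Dart, g a.edge := sum_darts.symm
    _ ≤ ∑ a : G.Dart, F a.fst a.snd := Finset.sum_le_sum fun a _ => h _ _ a.adj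
    _ = ∑ p ∈ Finset.univ.map ⟨_, SimpleGraph.Dart.toProd_injective (G := G)⟩, F p.1 p.2 := by
        rw [Finset.sum_map]
        rfl
    _ ≤ ∑ p : V × V, F p.1 p.2 := Finset.sum_le_univ_sum_of_nonneg fun p => hF _ _
    _ = ∑ i, ∑ v, F i v := Fintype.sum_prod_type _

theorem sum_sqrt_le_sqrt_card_mul_sum {ι : Type*} (s : Finset ι) {f : ι → ℝ} (hf : ∀ i, 0 ≤ f i) :
    ∑ i ∈ s, √(f i) ≤ √(s.card * ∑ i ∈ s, f i) := by
  rw [Real.sqrt_mul (Nat.cast_nonneg _)]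
  simpa using Real.sum_sqrt_mul_sqrt_le s (f := fun _ => 1) (fun _ => zero_le_one) hf

theorem exists_lt_add_sqrt_le {n : ℕ} (hn : 0 < n) (c : ℝ) {b L : ℝ} (hb : 0 ≤ b) {J : ℕ → ℝ}
    (hJ : ∀ k, 0 ≤ J k) (hL : ∑ k ∈ Finset.range n, J k ≤ L) :
    ∃ k < n, 2 * c * k + √(b * J k) ≤ c * (n - 1 : ℕ) + √(b * L / n) := by
  have sum_sqrt : ∑ k ∈ Finset.range n, √(b * J k) ≤ n * √(b * L / n) := by
    calc ∑ k ∈ Finset.range n, √(b * J k) ≤ √(n * (b * ∑ k ∈ Finset.range n, J k)) := by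
          simpa only [Finset.card_range, Finset.mul_sum] using
            sum_sqrt_le_sqrt_card_mul_sum (Finset.range n) fun k => mul_nonneg hb (hJ k)
      _ ≤ √(n * (b * L)) := by gcongr
      _ = √(n ^ 2 * (b * L / n)) := by congr 1; field_simp
      _ = n * √(b * L / n) := by rw [Real.sqrt_mul (sq_nonneg _), Real.sqrt_sq n.cast_nonneg]
  have sum_linear : ∑ k ∈ Finset.range n, 2 * c * k = n * (c * (n - 1 : ℕ)) := by
    have gauss := congrArg (Nat.cast (R := ℝ)) (Finset.sum_range_id_mul_two n)
    simp only [Nat.cast_mul, Nat.cast_sum, Nat.cast_ofNat] at gauss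
    rw [← Finset.mul_sum]
    linear_combination c * gauss
  obtain ⟨k, hk, h⟩ := Finset.exists_le_of_sum_le (s := Finset.range n)
    (f := fun k => 2 * c * k + √(b * J k)) (g := fun _ => c * (n - 1 : ℕ) + √(b * L / n))
    ⟨0, Finset.mem_range.mpr hn⟩ (by
      rw [Finset.sum_add_distrib, sum_linear, Finset.sum_const, Finset.card_range, nsmul_eq_mul,
        mul_add]
      gcongr)
  exact ⟨k, Finset.mem_range.mp hk, h⟩

end Chain

section SiteInformation

variable {V Ω : Type*}

theorem restrict_eq_restrict_iff {C : Finset V} {x y : V → Ω} :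
    C.restrict x = C.restrict y ↔ ∀ v ∈ C, x v = y v := by
  simp [funext_iff]

variable [Fintype V] [DecidableEq V] [Fintype Ω]

/-- The mutual information of the outcome at `i` and the outcomes at the other sites in `C`. -/
noncomputable def siteInfo (P : (V → Ω) → ℝ) (i : V) (C : Finset V) : ℝ :=
  entropy P (fun x => x i) + entropy P (C.erase i).restrict - entropy P (insert i C).restrict

theorem entropy_insert_restrict (P : (V → Ω) → ℝ) (i : V) (C : Finset V) :
    entropy P (insert i C).restrict = entropy P fun x => (x i, (C.erase i).restrict x) := by
  refine entropy_congr fun x y => ?_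
  simp only [restrict_eq_restrict_iff, Prod.mk.injEq, Finset.mem_insert, Finset.mem_erase]
  grind

theorem siteInfo_empty {P : (V → Ω) → ℝ} (hP₁ : ∑ x, P x = 1) (i : V) : siteInfo P i ∅ = 0 := by
  have prob_restrict_empty (z : (∅ : Finset V) → Ω) :
      prob P (∅ : Finset V).restrict z = 1 := by
    rw [← hP₁]
    exact Finset.sum_congr rfl fun y _ =>
      if_pos (funext fun v => absurd v.2 (Finset.notMem_empty _))
  have entropy_empty : entropy P (∅ : Finset V).restrict = 0 := by
    simp [entropy, prob_restrict_empty]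
  have entropy_singleton : entropy P (insert i (∅ : Finset V)).restrict = entropy P fun x => x i :=
    entropy_congr fun x y => by simp [restrict_eq_restrict_iff]
  rw [siteInfo, Finset.erase_empty, entropy_empty, entropy_singleton, add_zero, sub_self]

theorem siteInfo_insert_sub {P : (V → Ω) → ℝ} {i v : V} {C : Finset V} (hiv : i ≠ v) :
    siteInfo P i (insert v C) - siteInfo P i C
      = condMutualInfo P (fun x => x i) (fun x => x v) (C.erase i).restrict := by
  have entropy_pair : entropy P ((insert v C).erase i).restrict
      = entropy P fun x => (x v, (C.erase i).restrict x) := by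
    refine entropy_congr fun x y => ?_
    simp only [restrict_eq_restrict_iff, Prod.mk.injEq, Finset.mem_insert, Finset.mem_erase]
    grind
  have entropy_triple : entropy P (insert i (insert v C)).restrict
      = entropy P fun x => (x i, x v, (C.erase i).restrict x) := by
    refine entropy_congr fun x y => ?_
    simp only [restrict_eq_restrict_iff, Prod.mk.injEq, Finset.mem_insert, Finset.mem_erase]
    grind
  rw [siteInfo, siteInfo, condMutualInfo, entropy_pair, entropy_triple, entropy_insert_restrict]
  ring

theorem siteInfo_le_siteInfo_insert {P : (V → Ω) → ℝ} (hP : ∀ x, 0 ≤ P x) (i v : V)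
    (C : Finset V) : siteInfo P i C ≤ siteInfo P i (insert v C) := by
  rcases eq_or_ne i v with rfl | hiv
  · rw [siteInfo, siteInfo, Finset.erase_insert_eq_erase, Finset.insert_idem]
  · rw [← sub_nonneg, siteInfo_insert_sub hiv]
    exact condMutualInfo_nonneg hP _ _ _

theorem IsParsevalFrame.siteInfo_le_log_card {ι : Type*} [Fintype ι] [DecidableEq ι] [Nonempty ι]
    {m : Ω → ι → ℂ} (hm : IsParsevalFrame m) {ψ : (V → ι) → ℂ} (hψ : ∑ y, ‖ψ y‖ ^ 2 = 1) (i : V)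
    (C : Finset V) : siteInfo (outcomeProb m ψ) i C ≤ Real.log (Fintype.card ι) := by
  rw [siteInfo, entropy_insert_restrict]
  exact entropy_add_entropy_sub_entropy_le_log (outcomeProb_nonneg m ψ)
    ((hm.sum_outcomeProb ψ).trans hψ) _ _ (by exact_mod_cast Fintype.card_pos)
    (fun _ => Finset.sum_nonneg fun _ _ => sq_nonneg _) hm.sum_sum_norm_sq
    fun o z => hm.prob_prodMk_restrict_le ψ (Finset.notMem_erase i C) o z

end SiteInformation

section EdgeInformation

variable {V Ω : Type*} [Fintype V] [DecidableEq V] [Fintype Ω]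

/-- The mutual information of the outcomes at the two ends of an edge, given the outcomes at the
sites in `C`. It is set to `0` on the edges that meet `C`. -/
noncomputable def edgeInfo (P : (V → Ω) → ℝ) (C : Finset V) : Sym2 V → ℝ :=
  Sym2.lift ⟨fun i j => if i ∈ C ∨ j ∈ C then 0
      else condMutualInfo P (fun x => x i) (fun x => x j) C.restrict,
    fun _ _ => if_congr or_comm rfl (condMutualInfo_comm _ _ _)⟩

theorem edgeInfo_mk (P : (V → Ω) → ℝ) (C : Finset V) (i j : V) :
    edgeInfo P C s(i, j) = if i ∈ C ∨ j ∈ C then 0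
      else condMutualInfo P (fun x => x i) (fun x => x j) C.restrict :=
  rfl

variable {P : (V → Ω) → ℝ} (hP : ∀ x, 0 ≤ P x)

include hP

theorem edgeInfo_nonneg (C : Finset V) (e : Sym2 V) : 0 ≤ edgeInfo P C e := by
  induction e with | _ i j
  rw [edgeInfo_mk]
  split_ifs
  · exact le_rfl
  · exact condMutualInfo_nonneg hP _ _ _

theorem edgeInfo_le_siteInfo_insert_sub (C : Finset V) {i j : V} (hij : i ≠ j) :
    edgeInfo P C s(i, j) ≤ siteInfo P i (insert j C) - siteInfo P i C := by
  rw [edgeInfo_mk]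
  split_ifs with h
  · exact sub_nonneg.mpr (siteInfo_le_siteInfo_insert hP i j C)
  · rw [siteInfo_insert_sub hij, Finset.erase_eq_of_notMem fun hi => h (Or.inl hi)]

/-- The average over `v` of the increments of `∑ i, siteInfo P i C` counts every edge twice. -/
theorem exists_two_div_card_mul_sum_edgeInfo_le [Nonempty V] (G : SimpleGraph V)
    [DecidableRel G.Adj] (C : Finset V) :
    ∃ v, 2 / (Fintype.card V : ℝ) * ∑ e ∈ G.edgeFinset, edgeInfo P C e
      ≤ ∑ i, siteInfo P i (insert v C) - ∑ i, siteInfo P i C := by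
  have double_count : 2 * ∑ e ∈ G.edgeFinset, edgeInfo P C e
      ≤ ∑ v, (∑ i, siteInfo P i (insert v C) - ∑ i, siteInfo P i C) := by
    simp only [← Finset.sum_sub_distrib]
    rw [Finset.sum_comm]
    exact two_mul_sum_edgeFinset_le G
      (fun i v => sub_nonneg.mpr (siteInfo_le_siteInfo_insert hP i v C))
      fun i v hiv => edgeInfo_le_siteInfo_insert_sub hP C hiv.ne
  obtain ⟨v, -, hv⟩ := Finset.exists_le_of_sum_le (s := Finset.univ)
    (f := fun _ : V => 2 / (Fintype.card V : ℝ) * ∑ e ∈ G.edgeFinset, edgeInfo P C e)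
    Finset.univ_nonempty (double_count.trans' (le_of_eq (by simp; field_simp)))
  exact ⟨v, hv⟩

omit hP in
theorem IsParsevalFrame.exists_chain_edgeInfo [Nonempty V] {ι : Type*} [Fintype ι] [DecidableEq ι]
    [Nonempty ι] {m : Ω → ι → ℂ} (hm : IsParsevalFrame m) {ψ : (V → ι) → ℂ}
    (hψ : ∑ y, ‖ψ y‖ ^ 2 = 1) (G : SimpleGraph V) [DecidableRel G.Adj] :
    ∃ C : ℕ → Finset V, (∀ k, (C k).card ≤ k) ∧ ∀ n, ∑ k ∈ Finset.range n,
      2 / (Fintype.card V : ℝ) * ∑ e ∈ G.edgeFinset, edgeInfo (outcomeProb m ψ) (C k) e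
        ≤ Fintype.card V * Real.log (Fintype.card ι) := by
  obtain ⟨C, hC, h_chain⟩ := exists_chain (Φ := fun C => ∑ i, siteInfo (outcomeProb m ψ) i C)
    (exists_two_div_card_mul_sum_edgeInfo_le (outcomeProb_nonneg m ψ) G)
  refine ⟨C, hC, fun n => (h_chain n).trans ?_⟩
  calc _ = ∑ i, siteInfo (outcomeProb m ψ) i (C n) := by
        simp [siteInfo_empty ((hm.sum_outcomeProb ψ).trans hψ)]
    _ ≤ ∑ _ : V, Real.log (Fintype.card ι) :=
        Finset.sum_le_sum fun i _ => hm.siteInfo_le_log_card hψ i (C n)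
    _ = Fintype.card V * Real.log (Fintype.card ι) := by simp

end EdgeInformation

section Hamiltonian

open Matrix

variable {V : Type*} [Fintype V] [DecidableEq V] {d : ℕ}

theorem isContraction_of_opNorm_le_one {A : QuditOp V d} (hA : opNorm A ≤ 1) :
    IsContraction A := by
  intro φ
  have norm_le : ‖toEuclideanCLM (𝕜 := ℂ) A (WithLp.toLp 2 φ)‖ ≤ 1 * ‖WithLp.toLp 2 φ‖ :=
    ContinuousLinearMap.le_of_opNorm_le _ hA _
  rw [one_mul, ← sq_le_sq₀ (norm_nonneg _) (norm_nonneg _), EuclideanSpace.norm_sq_eq,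
    EuclideanSpace.norm_sq_eq] at norm_le
  exact norm_le

theorem expectation_eq_quadForm (H : QuditOp V d) (ψ : QuditSpace V d) :
    expectation H ψ = quadForm H ψ.ofLp := by
  rw [expectation, quadForm, EuclideanSpace.inner_eq_star_dotProduct, dotProduct_comm]
  rfl

theorem re_trace_mul_pureDensity (H : QuditOp V d) (ψ : QuditSpace V d) :
    (H * pureDensity ψ).trace.re = expectation H ψ := by
  have pureDensity_eq : pureDensity ψ = vecMulVec ψ.ofLp (star ψ.ofLp) := rfl
  rw [expectation_eq_quadForm, quadForm, pureDensity_eq, mul_vecMulVec, trace_vecMulVec,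
    dotProduct_comm]

theorem expectation_edgeAverage (G : SimpleGraph V) [DecidableRel G.Adj] (h : Sym2 V → QuditOp V d)
    (ψ : QuditSpace V d) : expectation (edgeAverage G h) ψ
      = (∑ e ∈ G.edgeFinset, quadForm (h e) ψ.ofLp) / G.edgeFinset.card := by
  rw [expectation_eq_quadForm, edgeAverage]
  simp only [quadForm, smul_mulVec, sum_mulVec, dotProduct_smul, dotProduct_sum, smul_eq_mul]
  rw [one_div_mul_eq_div, Complex.div_natCast_re, Complex.re_sum]

theorem card_filter_edgeFinset_le {G : SimpleGraph V} [DecidableRel G.Adj] {D : ℕ}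
    (hG : G.IsRegularOfDegree D) (C : Finset V) :
    (G.edgeFinset.filter fun e => ∃ v ∈ C, v ∈ e).card ≤ C.card * D := by
  have subset_biUnion : (G.edgeFinset.filter fun e => ∃ v ∈ C, v ∈ e)
      ⊆ C.biUnion fun v => G.incidenceFinset v := by
    intro e he
    obtain ⟨he, v, hv, hve⟩ := Finset.mem_filter.mp he
    exact Finset.mem_biUnion.mpr
      ⟨v, hv, (G.mem_incidenceFinset v e).mpr ⟨SimpleGraph.mem_edgeFinset.mp he, hve⟩⟩
  refine (Finset.card_le_card subset_biUnion).trans (Finset.card_biUnion_le_card_mul _ _ _ ?_)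
  intro v _
  rw [SimpleGraph.card_incidenceFinset_eq_degree, hG.degree_eq]

end Hamiltonian

section EnergyBounds

variable {V Ω : Type*} [Fintype V] [DecidableEq V] [Fintype Ω] {d : ℕ} [NeZero d]
  {m : Ω → Fin d → ℂ}

variable (hm : IsParsevalFrame m) {ψ : (V → Fin d) → ℂ} (hψ : ∑ y, ‖ψ y‖ ^ 2 = 1)

include hm hψ

theorem IsContraction.resampledMean_quadForm_le {A : QuditOp V d} (hA : IsContraction A)
    (C : Finset V) : resampledMean (outcomeProb m ψ) C.restrict
        (fun κ => quadForm A (piTensorVec (resampledState m ψ κ))) ≤ quadForm A ψ + 2 := by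
  calc _ ≤ resampledMean (outcomeProb m ψ) C.restrict fun _ => 1 :=
        resampledMean_mono (outcomeProb_nonneg m ψ) _ fun κ => (le_abs_self _).trans
          ((abs_quadForm_le hA _).trans_eq (sum_norm_sq_piTensorVec_resampledState m ψ κ))
    _ = 1 := resampledMean_const ((hm.sum_outcomeProb ψ).trans hψ) _ _
    _ ≤ quadForm A ψ + 2 := by
        have := neg_le_of_abs_le ((abs_quadForm_le hA ψ).trans_eq hψ)
        linarith

variable {S : ℝ} (hS : HasDistortion m S) (C : Finset V)

include hS

theorem HasDistortion.resampledMean_edge_le {e : Sym2 V} (he : ¬e.IsDiag) {A : QuditOp V d}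
    (hA : A.IsHermitian) (hA_local : ActsOnlyOn {v | v ∈ e} A) (hA₁ : IsContraction A) :
    resampledMean (outcomeProb m ψ) C.restrict
        (fun κ => quadForm A (piTensorVec (resampledState m ψ κ)))
      ≤ quadForm A ψ + ((if ∃ v ∈ C, v ∈ e then 2 else 0)
        + √(4 * S * edgeInfo (outcomeProb m ψ) C e)) := by
  split_ifs with h
  · refine (hA₁.resampledMean_quadForm_le hm hψ C).trans ?_
    gcongr
    exact le_add_of_nonneg_right (Real.sqrt_nonneg _)
  · induction e with | _ i j
    have hij : i ≠ j := he
    have hi : i ∉ C := fun hi => h ⟨i, hi, Sym2.mem_mk_left i j⟩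
    have hj : j ∉ C := fun hj => h ⟨j, hj, Sym2.mem_mk_right i j⟩
    rw [hA_local.eq_pairLift hij 0, edgeInfo_mk, if_neg (not_or.mpr ⟨hi, hj⟩), zero_add]
    exact hS.resampledMean_quadForm_le hm hψ hij hi hj (hA.submatrix _)
      (hA₁.submatrix (setPair_injective 0 hij))

variable {G : SimpleGraph V} [DecidableRel G.Adj] {D : ℕ} (hG : G.IsRegularOfDegree D)
  {h : Sym2 V → QuditOp V d} (h_herm : ∀ e ∈ G.edgeFinset, (h e).IsHermitian)
  (h_local : ∀ e ∈ G.edgeFinset, ActsOnlyOn {v : V | v ∈ e} (h e))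
  (h_contr : ∀ e ∈ G.edgeFinset, IsContraction (h e))

include hG h_herm h_local h_contr

theorem HasDistortion.exists_sum_quadForm_resampledState_le :
    ∃ κ, ∑ e ∈ G.edgeFinset, quadForm (h e) (piTensorVec (resampledState m ψ κ))
      ≤ ∑ e ∈ G.edgeFinset, quadForm (h e) ψ + (2 * (C.card * D)
        + ∑ e ∈ G.edgeFinset, √(4 * S * edgeInfo (outcomeProb m ψ) C e)) := by
  obtain ⟨κ, hκ⟩ := exists_le_resampledMean (outcomeProb_nonneg m ψ)
    ((hm.sum_outcomeProb ψ).trans hψ) C.restrict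
    fun κ => ∑ e ∈ G.edgeFinset, quadForm (h e) (piTensorVec (resampledState m ψ κ))
  refine ⟨κ, hκ.trans ?_⟩
  have card_le : ((G.edgeFinset.filter fun e => ∃ v ∈ C, v ∈ e).card : ℝ) ≤ C.card * D := by
    exact_mod_cast card_filter_edgeFinset_le hG C
  rw [resampledMean_sum]
  calc _ ≤ ∑ e ∈ G.edgeFinset, (quadForm (h e) ψ + ((if ∃ v ∈ C, v ∈ e then 2 else 0)
          + √(4 * S * edgeInfo (outcomeProb m ψ) C e))) :=
        Finset.sum_le_sum fun e he => hS.resampledMean_edge_le hm hψ C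
          (G.not_isDiag_of_mem_edgeFinset he) (h_herm e he) (h_local e he) (h_contr e he)
    _ ≤ _ := by
        rw [Finset.sum_add_distrib, Finset.sum_add_distrib, ← Finset.sum_filter, Finset.sum_const,
          nsmul_eq_mul, mul_comm]
        gcongr

end EnergyBounds

section EdgeAverageBounds

variable {V Ω : Type*} [Fintype V] [DecidableEq V] [Nonempty V] [Fintype Ω] {d D : ℕ} [NeZero d]
  {G : SimpleGraph V} [DecidableRel G.Adj] (hD : 0 < D) (hG : G.IsRegularOfDegree D)
  {h : Sym2 V → QuditOp V d} (h_herm : ∀ e ∈ G.edgeFinset, (h e).IsHermitian)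
  (h_local : ∀ e ∈ G.edgeFinset, ActsOnlyOn {v : V | v ∈ e} (h e))
  (h_contr : ∀ e ∈ G.edgeFinset, IsContraction (h e))

include hD hG h_herm h_local h_contr

theorem HasDistortion.exists_productVector_expectation_le {m : Ω → Fin d → ℂ}
    (hm : IsParsevalFrame m) {S : ℝ} (hS : HasDistortion m S) (hS₀ : 0 ≤ S) {ψ : QuditSpace V d}
    (hψ : ∑ y, ‖ψ y‖ ^ 2 = 1) (C : Finset V) :
    ∃ φ : V → EuclideanSpace ℂ (Fin d), (∀ v, ‖φ v‖ = 1) ∧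
      expectation (edgeAverage G h) (productVector φ) ≤ expectation (edgeAverage G h) ψ
        + (2 * (2 / Fintype.card V) * C.card + √(4 * S / D * (2 / Fintype.card V
          * ∑ e ∈ G.edgeFinset, edgeInfo (outcomeProb m ψ) C e))) := by
  have V_pos : (0 : ℝ) < Fintype.card V := by exact_mod_cast Fintype.card_pos
  have D_pos : (0 : ℝ) < D := by exact_mod_cast hD
  have card_edges : (G.edgeFinset.card : ℝ) = Fintype.card V * D / 2 := by
    have := G.sum_degrees_eq_twice_card_edges
    simp only [hG.degree_eq, Finset.sum_const, Finset.card_univ, smul_eq_mul] at this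
    rw [eq_div_iff two_ne_zero, mul_comm]
    exact_mod_cast this.symm
  obtain ⟨κ, hκ⟩ := hS.exists_sum_quadForm_resampledState_le hm hψ C hG h_herm h_local h_contr
  refine ⟨fun v => WithLp.toLp 2 (resampledState m ψ κ v), fun v => ?_, ?_⟩
  · rw [EuclideanSpace.norm_eq, Real.sqrt_eq_one]
    exact sum_norm_sq_unitVec _
  have sum_sqrt : ∑ e ∈ G.edgeFinset, √(4 * S * edgeInfo (outcomeProb m ψ) C e)
      ≤ G.edgeFinset.card * √(4 * S / D * (2 / Fintype.card V
        * ∑ e ∈ G.edgeFinset, edgeInfo (outcomeProb m ψ) C e)) := by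
    refine (sum_sqrt_le_sqrt_card_mul_sum G.edgeFinset fun e =>
      mul_nonneg (mul_nonneg zero_le_four hS₀)
        (edgeInfo_nonneg (outcomeProb_nonneg m ψ) C e)).trans_eq ?_
    rw [← Real.sqrt_sq (Nat.cast_nonneg G.edgeFinset.card), ← Real.sqrt_mul (sq_nonneg _),
      ← Finset.mul_sum, Real.sqrt_sq (Nat.cast_nonneg _), card_edges]
    congr 1
    field_simp
  rw [expectation_edgeAverage, expectation_edgeAverage]
  calc _ ≤ (∑ e ∈ G.edgeFinset, quadForm (h e) ψ.ofLp + (2 * (C.card * D)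
          + G.edgeFinset.card * √(4 * S / D * (2 / Fintype.card V
            * ∑ e ∈ G.edgeFinset, edgeInfo (outcomeProb m ψ) C e)))) / G.edgeFinset.card := by
        gcongr
        exact hκ.trans (by gcongr)
    _ = _ := by
        rw [card_edges]
        field_simp

end EdgeAverageBounds

theorem exists_pos_two_div_mul_add_sqrt_le {a N : ℝ} (ha : 0 ≤ a) (hN : 0 < N) :
    ∃ n : ℕ, 0 < n ∧ 2 / N * (n - 1 : ℕ) + √(96 * (N * a) / n) ≤ 12 * a ^ (1 / 3 : ℝ) := by
  set t := a ^ (1 / 3 : ℝ) with ht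
  have t_nonneg : 0 ≤ t := Real.rpow_nonneg ha _
  have t_cube : t ^ 3 = a := by
    rw [ht, ← Real.rpow_natCast, ← Real.rpow_mul ha]
    norm_num
  refine ⟨⌊2 * t * N⌋₊ + 1, Nat.succ_pos _, ?_⟩
  have linear_le : 2 / N * (⌊2 * t * N⌋₊ + 1 - 1 : ℕ) ≤ 4 * t := by
    calc _ ≤ 2 / N * (2 * t * N) := by
          gcongr
          exact Nat.floor_le (by positivity)
      _ = 4 * t := by rw [mul_comm, mul_assoc, mul_div_cancel₀ _ hN.ne']; ring
  have sqrt_le : √(96 * (N * a) / (⌊2 * t * N⌋₊ + 1 : ℕ)) ≤ 8 * t := by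
    refine Real.sqrt_le_iff.mpr ⟨mul_nonneg (by norm_num) t_nonneg,
      div_le_of_le_mul₀ (Nat.cast_nonneg _) (sq_nonneg _) ?_⟩
    calc 96 * (N * a) = 48 * t ^ 2 * (2 * t * N) := by rw [← t_cube]; ring
      _ ≤ (8 * t) ^ 2 * (⌊2 * t * N⌋₊ + 1 : ℕ) := by
          rw [mul_pow]
          gcongr
          · norm_num
          · exact_mod_cast (Nat.lt_floor_add_one _).le
  linarith

section EnergyGap

variable {V : Type*} [Fintype V] [DecidableEq V] [Nonempty V] {d D : ℕ} [NeZero d]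
  {G : SimpleGraph V} [DecidableRel G.Adj] (hD : 0 < D) (hG : G.IsRegularOfDegree D)
  {h : Sym2 V → QuditOp V d} (h_herm : ∀ e ∈ G.edgeFinset, (h e).IsHermitian)
  (h_local : ∀ e ∈ G.edgeFinset, ActsOnlyOn {v : V | v ∈ e} (h e))
  (h_contr : ∀ e ∈ G.edgeFinset, IsContraction (h e))

include hD hG h_herm h_local h_contr in
theorem exists_productVector_expectation_le {ψ : QuditSpace V d} (hψ : ‖ψ‖ = 1) :
    ∃ φ : V → EuclideanSpace ℂ (Fin d), (∀ v, ‖φ v‖ = 1) ∧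
      expectation (edgeAverage G h) (productVector φ) ≤ expectation (edgeAverage G h) ψ
        + 12 * ((d : ℝ) ^ 2 * Real.log d / D) ^ (1 / 3 : ℝ) := by
  have V_pos : (0 : ℝ) < Fintype.card V := by exact_mod_cast Fintype.card_pos
  rw [EuclideanSpace.norm_eq, Real.sqrt_eq_one] at hψ
  have frame := (isParsevalFrame_phaseVec (d := d)).isParsevalFrame_polarizedFrame
  have distortion := hasDistortion_polarizedFrame_phaseVec (d := d)
  obtain ⟨C, card_C_le, sum_info_le⟩ := frame.exists_chain_edgeInfo hψ G
  obtain ⟨n, n_pos, error_le⟩ := exists_pos_two_div_mul_add_sqrt_le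
    (a := (d : ℝ) ^ 2 * Real.log d / D) (by positivity) V_pos
  obtain ⟨k, -, loss_le⟩ := exists_lt_add_sqrt_le n_pos (2 / Fintype.card V)
    (b := 4 * (24 * d ^ 2) / D) (by positivity)
    (fun k => mul_nonneg (by positivity) (Finset.sum_nonneg fun e _ =>
      edgeInfo_nonneg (outcomeProb_nonneg _ ψ.ofLp) (C k) e)) (sum_info_le n)
  obtain ⟨φ, φ_unit, φ_le⟩ := distortion.exists_productVector_expectation_le hD hG h_herm h_local
    h_contr frame (by positivity) hψ (C k)
  refine ⟨φ, φ_unit, φ_le.trans (add_le_add_right ?_ _)⟩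
  calc _ ≤ 2 * (2 / (Fintype.card V : ℝ)) * k + _ := by
        gcongr
        exact card_C_le k
    _ ≤ _ := loss_le
    _ = 2 / (Fintype.card V : ℝ) * (n - 1 : ℕ)
        + √(96 * (Fintype.card V * ((d : ℝ) ^ 2 * Real.log d / D)) / n) := by
        rw [Fintype.card_fin]
        ring_nf
    _ ≤ _ := error_le

end EnergyGap

theorem mainTheorem4 {V : Type*} [Fintype V] [DecidableEq V] [Nonempty V]
    (G : SimpleGraph V) [DecidableRel G.Adj] (D d : ℕ) (hD : 0 < D) (hd : 0 < d)
    (hG : G.IsRegularOfDegree D)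
    (h : Sym2 V → QuditOp V d)
    (h_herm : ∀ e ∈ G.edgeFinset, (h e).IsHermitian)
    (h_local : ∀ e ∈ G.edgeFinset, ActsOnlyOn {v : V | v ∈ e} (h e))
    (h_norm : ∀ e ∈ G.edgeFinset, opNorm (h e) ≤ 1) :
    ∃ φ : V → EuclideanSpace ℂ (Fin d), (∀ v, ‖φ v‖ = 1) ∧
      (edgeAverage G h * pureDensity (productVector φ)).trace.re
        ≤ groundEnergy (edgeAverage G h)
          + 12 * ((d : ℝ) ^ 2 * Real.log d / D) ^ (1 / 3 : ℝ) := by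
  have : NeZero d := ⟨hd.ne'⟩
  obtain ⟨ψ, ψ_unit, ψ_ground⟩ := (isLeast_groundEnergy hd (edgeAverage G h)).1
  obtain ⟨φ, φ_unit, φ_le⟩ := exists_productVector_expectation_le hD hG h_herm h_local
    (fun e he => isContraction_of_opNorm_le_one (h_norm e he)) ψ_unit
  refine ⟨φ, φ_unit, ?_⟩
  rw [re_trace_mul_pureDensity, ← ψ_ground]
  exact φ_le
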